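/- **Setting.** Let $T\in\mathbb N$, let $S$ be a finite set of negative integers, $S^+=-S$, $Z^S=\{1,2,\dots\}\setminus S^+$, $\mathbb Z_-=\{-1,-2,\dots\}$, $U=S\cup\{0,1,2,\dots\}$, and let $\vec a(j)\in\mathbb C^T$ $(j\in Z^S)$ satisfy $\sum_{j\in Z^S}\sum_{k=1}^T|a_k(j)|<\infty$. Put $A(e^{i\lambda})=\sum_{j\in Z^S}\vec a(j)e^{-ij\lambda}$. A spectral density is an integrable $T\times T$ matrix function on $[-\pi,\pi)$ that is a.e. Hermitian nonnegative definite. For spectral densities $F$ (of $\vec\xi$) and $G$ (of the uncorrelated noise $\vec\eta$), $L_2^s(F+G)$ is the closed subspace of $L_2(F+G)$ generated by $e^{in\lambda}\delta_k$, $n\in\mathbb Z_-\setminus S$, $1\le k\le T$ ($\delta_k$ the unit vectors), and the linear estimate of $A\vec\xi=\sum_{j\in Z^S}\vec a(j)^\top\vec\xi(-j)$ from $\vec\xi(n)+\vec\eta(n)$, $n\in\mathbb Z_-\setminus S$, with spectral characteristic $h\in L_2^s(F+G)$ has mean square error $$\Delta(h;F,G)=\frac1{2\pi}\int_{-\pi}^{\pi}(A-h)^\top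 F\,\overline{(A-h)}\,d\lambda+\frac1{2\pi}\int_{-\pi}^{\pi}h^\top G\,\overline h\,d\lambda .$$ $h(F,G)$ is the minimizer of $\Delta(\cdot;F,G)$ over $L_2^s(F+G)$. For a class $D=D_F\times D_G$, a pair in $D$ is *least favorable* if it maximizes $\Delta(h(F,G);F,G)$ over $D$; $h^0$ is *minimax-robust* if $h^0\in H_D=\bigcap_{(F,G)\in D}L_2^s(F+G)$, $\max_D\Delta(h^0;F,G)$ exists, and $\max_D\Delta(h^0;F,G)\le\sup_D\Delta(h;F,G)$ for all $h\in H_D$. $F+G$ satisfies the *minimality condition* if it is a.e. invertible and $(F+G)^{-1}$ is integrable. Then put $$B(k,j)=\tfrac1{2\pi}\!\int_{-\pi}^{\pi}(F+G)^{-1}e^{-i(k-j)\lambda}d\lambda,\quad R(k,j)=\tfrac1{2\pi}\!\int_{-\pi}^{\pi}F(F+G)^{-1}e^{-i(k+j)\lambda}d\lambda,\quad Q(k,j)=\tfrac1{2\pi}\!\int_{-\pi}^{\pi}F(F+G)^{-1}G\,e^{-i(k-j)\lambda}d\lambda,$$ $(\mathbf R\mathbf a)(k)^\top=\sum_{j\in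 Z^S}\vec a(j)^\top R(k,j)$ and $(\mathbf B\mathbf c)(k)^\top=\sum_{j\in U}\vec c(j)^\top B(k,j)$ for $k\in U$, $\langle\mathbf Q\mathbf a,\mathbf a\rangle=\sum_{k,j\in Z^S}\vec a(k)^\top Q(k,j)\overline{\vec a(j)}$. Let $\mathbf B^{-1}\mathbf R\mathbf a$ be the solution $\mathbf c$ of $\mathbf B\mathbf c=\mathbf R\mathbf a$ in the completion of the finitely supported sequences on $U$ for the norm $\langle\mathbf B\mathbf c,\mathbf c\rangle^{1/2}$ (the usual $\ell_2$ solution if $\mathbf B$ is bounded with bounded inverse), with $\langle\mathbf R\mathbf a,\mathbf B^{-1}\mathbf R\mathbf a\rangle$ defined by continuity, and let $C(e^{i\lambda})=\sum_{k\in U}(\mathbf B^{-1}\mathbf R\mathbf a)(k)e^{ik\lambda}$ be the sum of its series, in the sense of convergence in $L_2((F+G)^{-1})$. **Classes.** With $p,p_k\in\mathbb R$, positive definite Hermitian $P,B_1$, and $\langle B_1,F\rangle=\sum_{k,l}(B_1)_{kl}f_{kl}$, let $D_0^1,\dots,D_0^4$ be the sets of spectral densities $F$ with, respectively, $\frac1{2\pi}\int\mathrm{Tr}\,F=p$;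 $\frac1{2\pi}\int f_{kk}=p_k$ for $k=1,\dots,T$; $\frac1{2\pi}\int\langle B_1,F\rangle=p$; $\frac1{2\pi}\int F=P$ (integrals over $[-\pi,\pi]$). **Corollary 4.** Let $k\in\{1,2,3,4\}$, let $G$ be a known spectral density, and let $F^0\in D_0^k$ be such that $F^0+G$ satisfies the minimality condition. Let $C^0$ be the series $C$ for $(F,G)=(F^0,G)$ and put $N=A^\top G+(C^0)^\top$ (a row vector), $N^*$ its conjugate transpose. Suppose that a.e. - for $k=1$: $N^*N=\alpha^2(F^0+G)^2$ for some $\alpha\in\mathbb R$; - for $k=2$: $N^*N=(F^0+G)\,\mathrm{diag}(\alpha_1^2,\dots,\alpha_T^2)\,(F^0+G)$ for some $\alpha_1,\dots,\alpha_T\in\mathbb R$; - for $k=3$: $N^*N=\alpha^2(F^0+G)B_1^\top(F^0+G)$ for some $\alpha\in\mathbb R$; - for $k=4$: $N^*N=(F^0+G)\,\vec\alpha\vec\alpha^{*}(F^0+G)$ for some $\vec\alpha\in\mathbb C^T$; and that $(F^0,G)$ maximizes $\langle\mathbf R\mathbf a,\mathbf B^{-1}\mathbf R\mathbf a\rangle+\langle\mathbf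 Q\mathbf a,\mathbf a\rangle$ over the pairs $(F,G)$, $F\in D_0^k$, with the minimality condition. Then $(F^0,G)$ is least favorable in $D_0^k\times\{G\}$, and $$(h^0)^\top=A^\top F^0(F^0+G)^{-1}-(C^0)^\top(F^0+G)^{-1}$$ is the spectral characteristic $h(F^0,G)$ of the optimal estimate and is, up to equality a.e., the unique minimax-robust spectral characteristic for $D_0^k\times\{G\}$. -/

import Mathlib

open MeasureTheory Filter Topology
open scoped ENNReal ComplexOrder Matrix

noncomputable section

namespace Filtering

instance instFactTwoPiPos : Fact (0 < 2 * Real.pi) := ⟨Real.two_pi_pos⟩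

/-- The frequency interval `[-π, π)`, as the circle `ℝ / 2πℤ`. Here `fourier n` is the
function `exp (i n λ)`. -/
abbrev Freq : Type := AddCircle (2 * Real.pi)

/-- The measure `dλ / 2π` on `[-π, π)`. -/
abbrev freqMeasure : Measure Freq := AddCircle.haarAddCircle

/-- Matrix-valued functions of the frequency. -/
abbrev MatFun (T : ℕ) : Type := Freq → Matrix (Fin T) (Fin T) ℂ

/-- Vector-valued functions of the frequency. -/
abbrev VecFun (T : ℕ) : Type := Freq → (Fin T → ℂ)

variable {T : ℕ}

/-! Spectral densities and weighted `L₂` spaces -/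

/-- `F` is the spectral density of a `T`-dimensional stationary sequence: its entries are
integrable and its values are almost everywhere Hermitian nonnegative definite. -/
def IsSpectralDensity (F : MatFun T) : Prop :=
  (∀ k l, Integrable (fun x => F x k l) freqMeasure) ∧ ∀ᵐ x ∂freqMeasure, (F x).PosSemidef

/-- The minimality condition: `F + G` is almost everywhere invertible and the inverse is
integrable. -/
def Minimality (F G : MatFun T) : Prop :=
  (∀ᵐ x ∂freqMeasure, IsUnit (F x + G x).det) ∧
    ∀ k l, Integrable (fun x => (F x + G x)⁻¹ k l) freqMeasure

/-- `(1 / 2π) ∫ vᵀ W v̄ dλ`, with values in `[0, ∞]`, for a weight `W` that is almost everywhere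
nonnegative definite. -/
def energy (W : MatFun T) (v : VecFun T) : ℝ≥0∞ :=
  ∫⁻ x, ENNReal.ofReal (v x ⬝ᵥ (W x *ᵥ star (v x))).re ∂freqMeasure

/-- `h` belongs to `L₂(W)`. -/
def MemL2 (W : MatFun T) (h : VecFun T) : Prop :=
  AEStronglyMeasurable h freqMeasure ∧ energy W h < ∞

/-- The trigonometric polynomial `∑ₙ c(n) exp (i n λ)` with vector coefficients. -/
def trigPoly (c : ℤ →₀ (Fin T → ℂ)) : VecFun T :=
  fun x => c.sum fun n v => fourier n x • v

/-- The observation times: the negative integers outside the set `S` of missing observations. -/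
def obsTimes (S : Finset ℤ) : Set ℤ := {n | n < 0 ∧ n ∉ S}

/-- The index set `U = S ∪ {0, 1, 2, …}`. -/
def unobsTimes (S : Finset ℤ) : Set ℤ := {n | n ∈ S ∨ 0 ≤ n}

/-- `Z^S = {1, 2, …} \ S⁺`, where `S⁺ = -S`. -/
def ZS (S : Finset ℤ) : Set ℕ := {j | 1 ≤ j ∧ -(j : ℤ) ∉ S}

/-- `L₂ˢ(W)`: the closed subspace of `L₂(W)` generated by the functions `exp (i n λ) δ_k`, `n` an
observation time, `k = 1, …, T`. -/
def MemL2s (S : Finset ℤ) (W : MatFun T) (h : VecFun T) : Prop :=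
  MemL2 W h ∧ ∀ ε : ℝ≥0∞, 0 < ε → ∃ c : ℤ →₀ (Fin T → ℂ),
    (c.support : Set ℤ) ⊆ obsTimes S ∧ energy W (h - trigPoly c) < ε

/-! The filtering problem -/

/-- `A(exp (iλ)) = ∑_{j ∈ Z^S} a(j) exp (-i j λ)`. -/
def funcA (S : Finset ℤ) (a : ℕ → Fin T → ℂ) : VecFun T :=
  fun x => ∑' j : ZS S, fourier (-((j : ℕ) : ℤ)) x • a j

/-- The mean square error `Δ(h; F, G)` of the linear estimate with spectral characteristic `h`. -/
def mse (S : Finset ℤ) (a : ℕ → Fin T → ℂ) (h : VecFun T) (F G : MatFun T) : ℝ≥0∞ :=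
  energy F (funcA S a - h) + energy G h

/-- `h` is the spectral characteristic `h(F, G)` of the mean square optimal linear estimate. -/
def IsOptimal (S : Finset ℤ) (a : ℕ → Fin T → ℂ) (F G : MatFun T) (h : VecFun T) : Prop :=
  MemL2s S (F + G) h ∧ ∀ g, MemL2s S (F + G) g → mse S a h F G ≤ mse S a g F G

/-- The mean square error `Δ(F, G) = Δ(h(F, G); F, G)` of the optimal linear estimate. -/
def optMse (S : Finset ℤ) (a : ℕ → Fin T → ℂ) (F G : MatFun T) : ℝ≥0∞ :=
  ⨅ h : {h : VecFun T // MemL2s S (F + G) h}, mse S a h F G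

/-- `F₀`, `G₀` are least favorable in the class `DF × DG` for the optimal linear filtering. -/
def IsLeastFavorable (S : Finset ℤ) (a : ℕ → Fin T → ℂ) (DF DG : Set (MatFun T))
    (F₀ G₀ : MatFun T) : Prop :=
  F₀ ∈ DF ∧ G₀ ∈ DG ∧ ∀ F ∈ DF, ∀ G ∈ DG, optMse S a F G ≤ optMse S a F₀ G₀

/-- `h` belongs to `H_D`, the intersection of the spaces `L₂ˢ(F + G)` over `F ∈ DF`, `G ∈ DG`. -/
def MemHD (S : Finset ℤ) (DF DG : Set (MatFun T)) (h : VecFun T) : Prop :=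
  ∀ F ∈ DF, ∀ G ∈ DG, MemL2s S (F + G) h

/-- `h₀` is minimax-robust for the class `DF × DG`: it lies in `H_D`, its largest error over the
class is attained, and no member of `H_D` has a smaller supremum of errors. -/
def IsMinimaxRobust (S : Finset ℤ) (a : ℕ → Fin T → ℂ) (DF DG : Set (MatFun T))
    (h₀ : VecFun T) : Prop :=
  MemHD S DF DG h₀ ∧
  (∃ F₁ ∈ DF, ∃ G₁ ∈ DG, ∀ F ∈ DF, ∀ G ∈ DG, mse S a h₀ F G ≤ mse S a h₀ F₁ G₁) ∧
  ∀ h, MemHD S DF DG h →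
    (⨆ F ∈ DF, ⨆ G ∈ DG, mse S a h₀ F G) ≤ ⨆ F ∈ DF, ⨆ G ∈ DG, mse S a h F G

/-! The operators `B`, `R`, `Q` -/

/-- Entrywise Fourier coefficient `(1 / 2π) ∫ M(λ) exp (-i n λ) dλ`. -/
def matCoeff (M : MatFun T) (n : ℤ) : Matrix (Fin T) (Fin T) ℂ :=
  Matrix.of fun p q => fourierCoeff (fun x => M x p q) n

def blockB (F G : MatFun T) (k j : ℤ) : Matrix (Fin T) (Fin T) ℂ :=
  matCoeff (fun x => (F x + G x)⁻¹) (k - j)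

def blockR (F G : MatFun T) (k j : ℤ) : Matrix (Fin T) (Fin T) ℂ :=
  matCoeff (fun x => F x * (F x + G x)⁻¹) (k + j)

def blockQ (F G : MatFun T) (k j : ℤ) : Matrix (Fin T) (Fin T) ℂ :=
  matCoeff (fun x => F x * (F x + G x)⁻¹ * G x) (k - j)

/-- `(R a)(k) = ∑_{j ∈ Z^S} a(j)ᵀ R(k, j)`. Vectors are row vectors, so blocks act from the
right. -/
def opR (S : Finset ℤ) (a : ℕ → Fin T → ℂ) (F G : MatFun T) (k : ℤ) : Fin T → ℂ :=
  ∑' j : ZS S, a j ᵥ* blockR F G k (j : ℕ)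

/-- `(B c)(k) = ∑_j c(j)ᵀ B(k, j)` for a finitely supported sequence `c`. -/
def opB (F G : MatFun T) (c : ℤ →₀ (Fin T → ℂ)) (k : ℤ) : Fin T → ℂ :=
  c.sum fun j v => v ᵥ* blockB F G k j

/-- `⟨Q a, a⟩ = ∑_{k, j ∈ Z^S} a(k)ᵀ Q(k, j) ā(j)`. -/
def formQ (S : Finset ℤ) (a : ℕ → Fin T → ℂ) (F G : MatFun T) : ℂ :=
  ∑' p : ZS S × ZS S, a p.1 ⬝ᵥ (blockQ F G (p.1 : ℕ) (p.2 : ℕ) *ᵥ star (a p.2))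

/-- `⟨R a, c⟩ = ∑_k (R a)(k)ᵀ c̄(k)` for a finitely supported sequence `c`. -/
def pairR (S : Finset ℤ) (a : ℕ → Fin T → ℂ) (F G : MatFun T) (c : ℤ →₀ (Fin T → ℂ)) : ℂ :=
  c.sum fun k v => opR S a F G k ⬝ᵥ star v

/-- The finitely supported sequences `c n` on `U` converge to `B⁻¹ R a`, and `C` is the sum of the
series `∑_{k ∈ U} (B⁻¹ R a)(k) exp (i k λ)`.

Under the minimality condition alone the positive matrix `B` need not be bounded in `ℓ₂`, and its
inverse is taken in the completion of the finitely supported sequences for the norm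
`⟨B c, c⟩ = (1 / 2π) ∫ Cᵀ (F + G)⁻¹ C̄ dλ`, `C = ∑ₖ c(k) exp (i k λ)`. If `B` is bounded with
bounded inverse in `ℓ₂`, this norm is equivalent to that of `ℓ₂`, and `B⁻¹ R a` is the usual one. -/
def ConvergesToInverse (S : Finset ℤ) (a : ℕ → Fin T → ℂ) (F G : MatFun T)
    (c : ℕ → ℤ →₀ (Fin T → ℂ)) (C : VecFun T) : Prop :=
  AEStronglyMeasurable C freqMeasure ∧
  (∀ n, ((c n).support : Set ℤ) ⊆ unobsTimes S) ∧
  Tendsto (fun n => energy (fun x => (F x + G x)⁻¹) (C - trigPoly (c n))) atTop (𝓝 0) ∧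
  ∀ k ∈ unobsTimes S, Tendsto (fun n => opB F G (c n) k) atTop (𝓝 (opR S a F G k))

/-- `C(exp (iλ)) = ∑_{k ∈ U} (B⁻¹ R a)(k) exp (i k λ)`. -/
def IsInverseSeries (S : Finset ℤ) (a : ℕ → Fin T → ℂ) (F G : MatFun T) (C : VecFun T) : Prop :=
  ∃ c, ConvergesToInverse S a F G c C

/-- `v = ⟨R a, B⁻¹ R a⟩ + ⟨Q a, a⟩`. -/
def IsObjective (S : Finset ℤ) (a : ℕ → Fin T → ℂ) (F G : MatFun T) (v : ℝ) : Prop :=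
  ∃ c C, ConvergesToInverse S a F G c C ∧
    Tendsto (fun n => pairR S a F G (c n) + formQ S a F G) atTop (𝓝 (v : ℂ))

/-- The pair `(F₀, G₀)` solves the optimization problem of maximizing
`⟨R a, B⁻¹ R a⟩ + ⟨Q a, a⟩` over the pairs in `DF × DG` with the minimality condition, that is,
those for which the operators are defined. -/
def SolvesExtremal (S : Finset ℤ) (a : ℕ → Fin T → ℂ) (DF DG : Set (MatFun T))
    (F₀ G₀ : MatFun T) : Prop :=
  F₀ ∈ DF ∧ G₀ ∈ DG ∧ ∃ v₀, IsObjective S a F₀ G₀ v₀ ∧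
    ∀ F ∈ DF, ∀ G ∈ DG, Minimality F G → ∀ v, IsObjective S a F G v → v ≤ v₀

/-- The spectral characteristic
`hᵀ = Aᵀ F (F + G)⁻¹ - (∑_{k ∈ U} (B⁻¹ R a)(k) exp (i k λ))ᵀ (F + G)⁻¹`, with `C` the series. -/
def specChar (S : Finset ℤ) (a : ℕ → Fin T → ℂ) (F G : MatFun T) (C : VecFun T) : VecFun T :=
  fun x => funcA S a x ᵥ* (F x * (F x + G x)⁻¹) - C x ᵥ* (F x + G x)⁻¹

/-! The classes of admissible densities and the relations for the least favorable density -/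

/-- The data of the four types of classes `D₀¹, D₀², D₀³, D₀⁴`. -/
inductive ClassData (T : ℕ) : Type
  | trace (p : ℝ) : ClassData T
  | diag (p : Fin T → ℝ) : ClassData T
  | weighted (B₁ : Matrix (Fin T) (Fin T) ℂ) (hB : B₁.PosDef) (p : ℝ) : ClassData T
  | full (P : Matrix (Fin T) (Fin T) ℂ) (hP : P.PosDef) : ClassData T

/-- The moment restriction of each class; `⟨B₁, F⟩ = ∑_{k, l} (B₁)_{kl} F_{kl}`. -/
def ClassData.restriction : ClassData T → MatFun T → Prop
  | .trace p, F => ∫ x, (F x).trace ∂freqMeasure = (p : ℂ)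
  | .diag p, F => ∀ k, ∫ x, F x k k ∂freqMeasure = (p k : ℂ)
  | .weighted B₁ _ p, F => ∫ x, (∑ k, ∑ l, B₁ k l * F x k l) ∂freqMeasure = (p : ℂ)
  | .full P _, F => ∀ k l, ∫ x, F x k l ∂freqMeasure = P k l

/-- The class of admissible spectral densities. -/
def ClassData.densities (K : ClassData T) : Set (MatFun T) :=
  {F | IsSpectralDensity F ∧ K.restriction F}

/-- The `T × T` matrix `r* rᵀ` (conjugate column times row) for `rᵀ = Aᵀ G + Cᵀ`. -/
def gramG (S : Finset ℤ) (a : ℕ → Fin T → ℂ) (G : MatFun T) (C : VecFun T) : MatFun T :=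
  fun x => Matrix.vecMulVec (star (funcA S a x ᵥ* G x + C x)) (funcA S a x ᵥ* G x + C x)

/-- The relation that determines the least favorable density in each class, with some Lagrange
multiplier: `α`, `α_k` real, respectively a vector `α`. -/
def ClassData.relation (S : Finset ℤ) (a : ℕ → Fin T → ℂ) (F G : MatFun T) (C : VecFun T) :
    ClassData T → Prop
  | .trace _ => ∃ α : ℝ, ∀ᵐ x ∂freqMeasure,
      gramG S a G C x = ((α : ℂ) ^ 2) • (F x + G x) ^ 2
  | .diag _ => ∃ α : Fin T → ℝ, ∀ᵐ x ∂freqMeasure,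
      gramG S a G C x = (F x + G x) * Matrix.diagonal (fun k => (α k : ℂ) ^ 2) * (F x + G x)
  | .weighted B₁ _ _ => ∃ α : ℝ, ∀ᵐ x ∂freqMeasure,
      gramG S a G C x = ((α : ℂ) ^ 2) • ((F x + G x) * B₁ᵀ * (F x + G x))
  | .full _ _ => ∃ α : Fin T → ℂ, ∀ᵐ x ∂freqMeasure,
      gramG S a G C x = (F x + G x) * Matrix.vecMulVec α (star α) * (F x + G x)

end Filtering

end

noncomputable section

namespace Filtering

variable {T : ℕ}

/-! Write h⁰ for `specChar` at (F⁰, G) and u = A - h⁰. Where F⁰ + G is invertible, uᵀ = N (F⁰ +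
G)⁻¹, so each of the four relations says that the Gram matrix of u is a.e. a constant matrix M made
of the multipliers (`gram_residual`). This has two consequences. First, |u|² is a.e. constant, so h⁰
is bounded. Second, uᵀ F ū = tr(F M), so the signal part of the error depends on F only through the
moments fixed by the class (`ClassData.exists_multiplier`), while the noise part does not involve F.
Hence h⁰ has the same finite error at every F of the class.

The equation B c = R a makes the Fourier coefficients of h⁰ vanish on U (`fourierCoeff_specChar`).
The Fejér means of the bounded function h⁰ are then polynomials in the observed frequencies, and
they converge to h⁰ in L₂(F + G) for every spectral density F, with or without minimality
(`memL2s_of_bounded`). So h⁰ lies in H_D.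

At F⁰ itself, the linear term of the error around h⁰ is the pairing with C (`sform_specChar`). Since
C is a limit in L₂((F⁰ + G)⁻¹) of polynomials with frequencies in U, it annihilates L₂ˢ(F⁰ + G),
whence Δ(g) = Δ(h⁰) + ‖g - h⁰‖² (`mse_eq_add_energy`). So h⁰ is optimal at F⁰, and with the
constancy of its error this is a saddle point: F⁰ is least favorable and h⁰ is minimax. A minimax h
satisfies Δ(h; F⁰, G) ≤ Δ(h⁰; F⁰, G), which forces ‖h - h⁰‖ = 0. -/

/-! ### Pointwise algebra of nonnegative forms -/

/-- The sesquilinear form `uᵀ W v̄`. -/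
def sform (W : Matrix (Fin T) (Fin T) ℂ) (u v : Fin T → ℂ) : ℂ := u ⬝ᵥ (W *ᵥ star v)

open scoped MatrixOrder in
theorem exists_factor {W : Matrix (Fin T) (Fin T) ℂ} (hW : W.PosSemidef) :
    ∃ B : Matrix (Fin T) (Fin T) ℂ, W = Bᴴ * B := by
  obtain ⟨B, hB⟩ := CStarAlgebra.nonneg_iff_eq_star_mul_self.mp hW.nonneg
  exact ⟨B, hB⟩

theorem sform_factor (B : Matrix (Fin T) (Fin T) ℂ) (u v : Fin T → ℂ) :
    sform (Bᴴ * B) u v = (u ᵥ* Bᴴ) ⬝ᵥ star (v ᵥ* Bᴴ) := by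
  rw [sform, Matrix.star_vecMul, Matrix.conjTranspose_conjTranspose, ← Matrix.mulVec_mulVec,
    Matrix.dotProduct_mulVec]

theorem dotProduct_star_self_re (u : Fin T → ℂ) : (u ⬝ᵥ star u).re = ∑ i, ‖u i‖ ^ 2 := by
  simp [dotProduct, Complex.mul_conj, Complex.normSq_eq_norm_sq, -Complex.ofReal_pow]

theorem norm_dotProduct_star_sq_le (u v : Fin T → ℂ) :
    ‖u ⬝ᵥ star v‖ ^ 2 ≤ (∑ i, ‖u i‖ ^ 2) * ∑ i, ‖v i‖ ^ 2 := by
  have h : ‖u ⬝ᵥ star v‖ ≤ ∑ i, ‖u i‖ * ‖v i‖ := by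
    refine (norm_sum_le _ _).trans (le_of_eq ?_)
    simp
  exact (pow_le_pow_left₀ (norm_nonneg _) h 2).trans (Finset.sum_mul_sq_le_sq_mul_sq _ _ _)

theorem sform_self_nonneg {W : Matrix (Fin T) (Fin T) ℂ} (hW : W.PosSemidef) (u : Fin T → ℂ) :
    0 ≤ (sform W u u).re := by
  obtain ⟨B, rfl⟩ := exists_factor hW
  rw [sform_factor, dotProduct_star_self_re]
  positivity

/-- A factorization W = BᴴB turns the form into the Euclidean inner product of u Bᴴ and v Bᴴ;
invertibility of W plays no role. -/
theorem norm_sform_sq_le {W : Matrix (Fin T) (Fin T) ℂ} (hW : W.PosSemidef) (u v : Fin T → ℂ) :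
    ‖sform W u v‖ ^ 2 ≤ (sform W u u).re * (sform W v v).re := by
  obtain ⟨B, rfl⟩ := exists_factor hW
  simp only [sform_factor, dotProduct_star_self_re]
  exact norm_dotProduct_star_sq_le _ _

theorem sform_eq_sum (W : Matrix (Fin T) (Fin T) ℂ) (u v : Fin T → ℂ) :
    sform W u v = ∑ i, ∑ j, u i * (W i j * star (v j)) := by
  simp [sform, dotProduct, Matrix.mulVec, Finset.mul_sum]

theorem sform_conj {W : Matrix (Fin T) (Fin T) ℂ} (hW : W.IsHermitian) (u v : Fin T → ℂ) :
    star (sform W u v) = sform W v u := by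
  simp only [sform_eq_sum, star_sum, star_mul', star_star]
  rw [Finset.sum_comm]
  refine Finset.sum_congr rfl fun i _ => Finset.sum_congr rfl fun j _ => ?_
  rw [hW.apply]
  ring

theorem sform_add_left (W : Matrix (Fin T) (Fin T) ℂ) (u u' v : Fin T → ℂ) :
    sform W (u + u') v = sform W u v + sform W u' v := by
  simp [sform, add_dotProduct]

theorem sform_sub_left (W : Matrix (Fin T) (Fin T) ℂ) (u u' v : Fin T → ℂ) :
    sform W (u - u') v = sform W u v - sform W u' v := by
  simp [sform, sub_dotProduct]

theorem sform_add_right (W : Matrix (Fin T) (Fin T) ℂ) (u v v' : Fin T → ℂ) :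
    sform W u (v + v') = sform W u v + sform W u v' := by
  simp [sform, Matrix.mulVec_add, dotProduct_add]

theorem sform_sub_right (W : Matrix (Fin T) (Fin T) ℂ) (u v v' : Fin T → ℂ) :
    sform W u (v - v') = sform W u v - sform W u v' := by
  simp [sform, Matrix.mulVec_sub, dotProduct_sub]

theorem sform_add_weight (F G : Matrix (Fin T) (Fin T) ℂ) (u v : Fin T → ℂ) :
    sform (F + G) u v = sform F u v + sform G u v := by
  simp [sform, Matrix.add_mulVec, dotProduct_add]

/-- Crude, but it lets integrable entries of W control the energy of any bounded v. -/
theorem norm_sform_self_le (W : Matrix (Fin T) (Fin T) ℂ) (v : Fin T → ℂ) :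
    ‖sform W v v‖ ≤ (∑ i, ∑ j, ‖W i j‖) * ∑ k, ‖v k‖ ^ 2 := by
  rw [sform_eq_sum, Finset.sum_mul]
  refine norm_sum_le_of_le _ fun i _ => ?_
  rw [Finset.sum_mul]
  refine norm_sum_le_of_le _ fun j _ => ?_
  rw [norm_mul, norm_mul, norm_star]
  have hi : ‖v i‖ ^ 2 ≤ ∑ k, ‖v k‖ ^ 2 :=
    Finset.single_le_sum (f := fun k => ‖v k‖ ^ 2) (fun _ _ => by positivity) (Finset.mem_univ i)
  have hj : ‖v j‖ ^ 2 ≤ ∑ k, ‖v k‖ ^ 2 :=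
    Finset.single_le_sum (f := fun k => ‖v k‖ ^ 2) (fun _ _ => by positivity) (Finset.mem_univ j)
  have : ‖v i‖ * ‖v j‖ ≤ ∑ k, ‖v k‖ ^ 2 := by nlinarith [sq_nonneg (‖v i‖ - ‖v j‖)]
  calc _ = ‖W i j‖ * (‖v i‖ * ‖v j‖) := by ring
    _ ≤ _ := by gcongr

/-- Cauchy–Schwarz for the duality between the weights `W⁻¹` and `W`. -/
theorem norm_dotProduct_star_sq_le_inv {W : Matrix (Fin T) (Fin T) ℂ} (hW : W.PosSemidef)
    (hu : IsUnit W.det) (u g : Fin T → ℂ) :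
    ‖u ⬝ᵥ star g‖ ^ 2 ≤ (sform W⁻¹ u u).re * (sform W g g).re := by
  -- Replacing u by u W⁻¹ makes the W-form against g the plain pairing of u with g.
  have h := norm_sform_sq_le hW (u ᵥ* W⁻¹) g
  have h1 (v : Fin T → ℂ) : sform W (u ᵥ* W⁻¹) v = u ⬝ᵥ star v := by
    rw [sform, ← Matrix.dotProduct_mulVec, Matrix.mulVec_mulVec, Matrix.nonsing_inv_mul _ hu,
      Matrix.one_mulVec]
  have h2 : sform W⁻¹ u u = u ⬝ᵥ star (u ᵥ* W⁻¹) := by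
    rw [sform, Matrix.star_vecMul, hW.isHermitian.inv.eq]
  rwa [h1, h1, ← h2] at h

/-- The two sides differ by the form at u - v, which is nonnegative. -/
theorem sform_self_add_le {W : Matrix (Fin T) (Fin T) ℂ} (hW : W.PosSemidef) (u v : Fin T → ℂ) :
    (sform W (u + v) (u + v)).re ≤ 2 * (sform W u u).re + 2 * (sform W v v).re := by
  have h := sform_self_nonneg hW (u - v)
  simp only [sform_add_left, sform_add_right, sform_sub_left, sform_sub_right, Complex.add_re,
    Complex.sub_re] at h ⊢
  linarith

/-- Expansion of the quadratic error around an estimate `h` with residual `u`. -/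
theorem sform_error_expansion {F G : Matrix (Fin T) (Fin T) ℂ} (hF : F.IsHermitian)
    (hG : G.IsHermitian) (u h d : Fin T → ℂ) :
    (sform F (u - d) (u - d)).re + (sform G (h + d) (h + d)).re =
      (sform F u u).re + (sform G h h).re + (sform (F + G) d d).re
        - 2 * (sform F u d - sform G h d).re := by
  have h1 : (sform F d u).re = (sform F u d).re := by
    rw [← sform_conj hF u d]; simp
  have h2 : (sform G d h).re = (sform G h d).re := by
    rw [← sform_conj hG h d]; simp
  simp only [sform_add_left, sform_add_right, sform_sub_left, sform_sub_right, Complex.add_re,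
    Complex.sub_re, sform_add_weight, h1, h2]
  ring

/-! Energies of vector functions -/

/-- The entries of `W` are almost everywhere strongly measurable. -/
def EntrywiseAESM (W : MatFun T) : Prop :=
  ∀ k l, AEStronglyMeasurable (fun x => W x k l) freqMeasure

theorem IsSpectralDensity.entrywiseAESM {W : MatFun T} (hW : IsSpectralDensity W) :
    EntrywiseAESM W := fun k l => (hW.1 k l).aestronglyMeasurable

theorem IsSpectralDensity.add {F G : MatFun T} (hF : IsSpectralDensity F)
    (hG : IsSpectralDensity G) : IsSpectralDensity (F + G) := by
  refine ⟨fun k l => (hF.1 k l).add (hG.1 k l), ?_⟩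
  filter_upwards [hF.2, hG.2] with x h1 h2 using h1.add h2

theorem _root_.MeasureTheory.AEStronglyMeasurable.component {v : VecFun T}
    (hv : AEStronglyMeasurable v freqMeasure) (k : Fin T) :
    AEStronglyMeasurable (fun x => v x k) freqMeasure :=
  (continuous_apply k).comp_aestronglyMeasurable hv

theorem aestronglyMeasurable_vecFun {v : VecFun T}
    (h : ∀ k, AEStronglyMeasurable (fun x => v x k) freqMeasure) :
    AEStronglyMeasurable v freqMeasure :=
  (aemeasurable_pi_lambda v fun k => (h k).aemeasurable).aestronglyMeasurable

theorem aestronglyMeasurable_dotProduct {u v : VecFun T}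
    (hu : AEStronglyMeasurable u freqMeasure) (hv : AEStronglyMeasurable v freqMeasure) :
    AEStronglyMeasurable (fun x => u x ⬝ᵥ v x) freqMeasure :=
  Finset.aestronglyMeasurable_fun_sum _ fun i _ => (hu.component i).mul (hv.component i)

theorem EntrywiseAESM.mulVec {W : MatFun T} (hW : EntrywiseAESM W) {v : VecFun T}
    (hv : AEStronglyMeasurable v freqMeasure) :
    AEStronglyMeasurable (fun x => W x *ᵥ v x) freqMeasure :=
  aestronglyMeasurable_vecFun fun k =>
    aestronglyMeasurable_dotProduct (aestronglyMeasurable_vecFun fun i => hW k i) hv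

theorem EntrywiseAESM.vecMul {W : MatFun T} (hW : EntrywiseAESM W) {v : VecFun T}
    (hv : AEStronglyMeasurable v freqMeasure) :
    AEStronglyMeasurable (fun x => v x ᵥ* W x) freqMeasure :=
  aestronglyMeasurable_vecFun fun k =>
    aestronglyMeasurable_dotProduct hv (aestronglyMeasurable_vecFun fun i => hW i k)

theorem EntrywiseAESM.mul {V W : MatFun T} (hV : EntrywiseAESM V) (hW : EntrywiseAESM W) :
    EntrywiseAESM fun x => V x * W x := fun k l => by
  simp only [Matrix.mul_apply]
  exact Finset.aestronglyMeasurable_fun_sum _ fun i _ => (hV k i).mul (hW i l)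

theorem aestronglyMeasurable_star {v : VecFun T}
    (hv : AEStronglyMeasurable v freqMeasure) :
    AEStronglyMeasurable (fun x => star (v x)) freqMeasure :=
  continuous_star.comp_aestronglyMeasurable hv

theorem EntrywiseAESM.sform {W : MatFun T} (hW : EntrywiseAESM W) {u v : VecFun T}
    (hu : AEStronglyMeasurable u freqMeasure) (hv : AEStronglyMeasurable v freqMeasure) :
    AEStronglyMeasurable (fun x => sform (W x) (u x) (v x)) freqMeasure :=
  aestronglyMeasurable_dotProduct hu (hW.mulVec (aestronglyMeasurable_star hv))

theorem EntrywiseAESM.sform_re {W : MatFun T} (hW : EntrywiseAESM W) {u v : VecFun T}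
    (hu : AEStronglyMeasurable u freqMeasure) (hv : AEStronglyMeasurable v freqMeasure) :
    AEStronglyMeasurable (fun x => (Filtering.sform (W x) (u x) (v x)).re) freqMeasure :=
  Complex.continuous_re.comp_aestronglyMeasurable (hW.sform hu hv)

theorem energy_eq_lintegral (W : MatFun T) (v : VecFun T) :
    energy W v = ∫⁻ x, ENNReal.ofReal (sform (W x) (v x) (v x)).re ∂freqMeasure := rfl

theorem ae_sform_nonneg {W : MatFun T} (hW : ∀ᵐ x ∂freqMeasure, (W x).PosSemidef)
    (v : VecFun T) : 0 ≤ᵐ[freqMeasure] fun x => (sform (W x) (v x) (v x)).re :=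
  hW.mono fun x hx => sform_self_nonneg hx (v x)

theorem energy_eq_ofReal_integral {W : MatFun T} (hW : ∀ᵐ x ∂freqMeasure, (W x).PosSemidef)
    {v : VecFun T} (hi : Integrable (fun x => (sform (W x) (v x) (v x)).re) freqMeasure) :
    energy W v = ENNReal.ofReal (∫ x, (sform (W x) (v x) (v x)).re ∂freqMeasure) :=
  (ofReal_integral_eq_lintegral_ofReal hi (ae_sform_nonneg hW v)).symm

theorem integrable_of_energy_lt_top {W : MatFun T} (hWm : EntrywiseAESM W)
    (hW : ∀ᵐ x ∂freqMeasure, (W x).PosSemidef) {v : VecFun T}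
    (hv : AEStronglyMeasurable v freqMeasure) (h : energy W v < ∞) :
    Integrable (fun x => (sform (W x) (v x) (v x)).re) freqMeasure :=
  ⟨hWm.sform_re hv hv, (hasFiniteIntegral_iff_ofReal (ae_sform_nonneg hW v)).2 h⟩

theorem energy_lt_top_of_integrable {W : MatFun T} (hW : ∀ᵐ x ∂freqMeasure, (W x).PosSemidef)
    {v : VecFun T} (hi : Integrable (fun x => (sform (W x) (v x) (v x)).re) freqMeasure) :
    energy W v < ∞ := by
  rw [energy_eq_ofReal_integral hW hi]; exact ENNReal.ofReal_lt_top

theorem integrable_sum_norm {W : MatFun T}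
    (hW : ∀ k l, Integrable (fun x => W x k l) freqMeasure) :
    Integrable (fun x => ∑ i, ∑ j, ‖W x i j‖) freqMeasure :=
  integrable_finsetSum _ fun i _ => integrable_finsetSum _ fun j _ => (hW i j).norm

theorem integrable_sform_of_bounded {W : MatFun T}
    (hW : ∀ k l, Integrable (fun x => W x k l) freqMeasure) {v : VecFun T}
    (hv : AEStronglyMeasurable v freqMeasure) {M : ℝ}
    (hM : ∀ᵐ x ∂freqMeasure, ∑ k, ‖v x k‖ ^ 2 ≤ M) :
    Integrable (fun x => (sform (W x) (v x) (v x)).re) freqMeasure := by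
  have hWm : EntrywiseAESM W := fun k l => (hW k l).aestronglyMeasurable
  refine Integrable.mono' ((integrable_sum_norm hW).mul_const M) (hWm.sform_re hv hv) ?_
  filter_upwards [hM] with x hx
  refine (Complex.abs_re_le_norm _).trans ((norm_sform_self_le _ _).trans ?_)
  gcongr

theorem energy_add_le {W : MatFun T} (hWm : EntrywiseAESM W)
    (hW : ∀ᵐ x ∂freqMeasure, (W x).PosSemidef) {u v : VecFun T}
    (hu : AEStronglyMeasurable u freqMeasure) :
    energy W (u + v) ≤ 2 * energy W u + 2 * energy W v := by
  simp only [energy_eq_lintegral]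
  rw [← lintegral_const_mul' _ _ (by simp), ← lintegral_const_mul' _ _ (by simp),
    ← lintegral_add_left' ((hWm.sform_re hu hu).aemeasurable.ennreal_ofReal.const_mul _)]
  refine lintegral_mono_ae ?_
  filter_upwards [hW] with x hx
  have h2 : (2 : ℝ≥0∞) = ENNReal.ofReal 2 := by simp
  rw [h2, ← ENNReal.ofReal_mul (by norm_num), ← ENNReal.ofReal_mul (by norm_num),
    ← ENNReal.ofReal_add (mul_nonneg (by norm_num) (sform_self_nonneg hx _))
      (mul_nonneg (by norm_num) (sform_self_nonneg hx _))]
  exact ENNReal.ofReal_le_ofReal (sform_self_add_le hx _ _)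

theorem energy_neg (W : MatFun T) (v : VecFun T) : energy W (-v) = energy W v := by
  simp [energy, Matrix.mulVec_neg]

theorem energy_congr {W : MatFun T} {u v : VecFun T} (h : u =ᵐ[freqMeasure] v) :
    energy W u = energy W v :=
  lintegral_congr_ae (h.mono fun x hx => by simp only [hx])

/-- The pointwise duality inequality is integrated by Hölder with p = q = 2; energies are squared
norms, hence the powers 1/2. -/
theorem lintegral_pairing_le {W : MatFun T} (hWm : EntrywiseAESM W)
    (hWim : EntrywiseAESM fun x => (W x)⁻¹)
    (hW : ∀ᵐ x ∂freqMeasure, (W x).PosSemidef) (hunit : ∀ᵐ x ∂freqMeasure, IsUnit (W x).det)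
    {u g : VecFun T} (hu : AEStronglyMeasurable u freqMeasure)
    (hg : AEStronglyMeasurable g freqMeasure) :
    ∫⁻ x, ‖u x ⬝ᵥ star (g x)‖ₑ ∂freqMeasure ≤
      energy (fun x => (W x)⁻¹) u ^ (1 / 2 : ℝ) * energy W g ^ (1 / 2 : ℝ) := by
  have key := ENNReal.lintegral_mul_le_Lp_mul_Lq freqMeasure Real.HolderConjugate.two_two
    ((hWim.sform_re hu hu).aemeasurable.ennreal_ofReal.pow_const (1 / 2 : ℝ))
    ((hWm.sform_re hg hg).aemeasurable.ennreal_ofReal.pow_const (1 / 2 : ℝ))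
  have hs (y : ℝ≥0∞) : (y ^ (1 / 2 : ℝ)) ^ (2 : ℝ) = y := by
    rw [← ENNReal.rpow_mul]; norm_num
  simp only [hs] at key
  refine le_trans (lintegral_mono_ae ?_) key
  filter_upwards [hW, hunit] with x hx hux
  have h := norm_dotProduct_star_sq_le_inv hx hux (u x) (g x)
  simp only [Pi.mul_apply]
  rw [← ENNReal.mul_rpow_of_nonneg _ _ (by norm_num),
    ← ENNReal.ofReal_mul (sform_self_nonneg hx.inv _), ← ofReal_norm]
  refine le_trans (le_of_eq ?_) (ENNReal.rpow_le_rpow (ENNReal.ofReal_le_ofReal h) (by norm_num))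
  rw [ENNReal.ofReal_pow (norm_nonneg _), ← ENNReal.rpow_natCast, ← ENNReal.rpow_mul]
  norm_num

/-! Fejér means -/

/-- The Fejér mean of order `N` of the Fourier series of `g`. -/
def fejerMean (g : Freq → ℂ) (N : ℕ) (x : Freq) : ℂ :=
  (N : ℂ)⁻¹ * ∑ p ∈ Finset.range N, ∑ q ∈ Finset.range N,
    fourierCoeff g ((p : ℤ) - q) * fourier ((p : ℤ) - q) x

/-- Both sides count f n with weight N - |n|. It identifies the Cesàro mean of the Fourier partial
sums with the double sum that exhibits the positive kernel. In the induction, the new row, column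
and corner of the square are the frequencies of the next partial sum. -/
theorem sum_symmetric_partial_sums {E : Type*} [AddCommMonoid E] (f : ℤ → E) (N : ℕ) :
    ∑ m ∈ Finset.range N, ∑ n ∈ Finset.Icc (-(m : ℤ)) m, f n =
      ∑ p ∈ Finset.range N, ∑ q ∈ Finset.range N, f ((p : ℤ) - q) := by
  have hD (m : ℕ) : ∑ n ∈ Finset.Icc (-(m : ℤ)) m, f n =
      ∑ p ∈ Finset.range m, f ((p : ℤ) - m) + (∑ q ∈ Finset.range m, f ((m : ℤ) - q) + f 0) := by
    have h : Finset.Icc (-(m : ℤ)) m =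
        (Finset.range m).image (fun p : ℕ => (p : ℤ) - m) ∪
          ((Finset.range m).image (fun q : ℕ => (m : ℤ) - q) ∪ {0}) := by
      ext n
      simp only [Finset.mem_Icc, Finset.mem_union, Finset.mem_image, Finset.mem_range,
        Finset.mem_singleton]
      constructor
      · rintro ⟨h1, h2⟩
        rcases lt_trichotomy n 0 with h | h | h
        · exact Or.inl ⟨(n + m).toNat, by omega, by omega⟩
        · exact Or.inr (Or.inr h)
        · exact Or.inr (Or.inl ⟨(m - n).toNat, by omega, by omega⟩)
      · rintro (⟨a, h1, h2⟩ | ⟨a, h1, h2⟩ | h) <;> omega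
    rw [h, Finset.sum_union, Finset.sum_union, Finset.sum_image, Finset.sum_image,
      Finset.sum_singleton]
    · intro a _ b _ h; simpa using h
    · intro a _ b _ h; simpa using h
    · rw [Finset.disjoint_singleton_right]; simp; omega
    · rw [Finset.disjoint_left]
      intro n
      simp only [Finset.mem_union, Finset.mem_image, Finset.mem_range, Finset.mem_singleton]
      rintro ⟨a, h1, h2⟩ (⟨b, h3, h4⟩ | h) <;> omega
  induction N with
  | zero => simp
  | succ N ih =>
    rw [Finset.sum_range_succ, ih, hD, Finset.sum_range_succ]
    simp only [Finset.sum_range_succ, Finset.sum_add_distrib, sub_self]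
    abel

/-- The sum over p, q factors as a sum times its conjugate, so the Fejér kernel is nonnegative. -/
theorem fejerMean_eq_integral {g : Freq → ℂ} (hg : Integrable g freqMeasure) (N : ℕ) (x : Freq) :
    fejerMean g N x = (N : ℂ)⁻¹ * ∫ t,
      ((‖∑ p ∈ Finset.range N, fourier (p : ℤ) x * fourier (-(p : ℤ)) t‖ ^ 2 : ℝ) : ℂ) * g t
        ∂freqMeasure := by
  have hi (p q : ℕ) : Integrable (fun t : Freq => fourier (-((p : ℤ) - q)) t * g t *
      fourier ((p : ℤ) - q) x) freqMeasure := by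
    have := (hg.fourier_smul (-((p : ℤ) - q))).mul_const (fourier ((p : ℤ) - q) x)
    simpa only [smul_eq_mul] using this
  rw [fejerMean]
  congr 1
  simp only [fourierCoeff, smul_eq_mul, ← integral_mul_const]
  rw [Finset.sum_congr rfl fun p _ => (integral_finsetSum _ fun q _ => hi p q).symm,
    ← integral_finsetSum _ fun p _ => integrable_finsetSum _ fun q _ => hi p q]
  refine integral_congr_ae (Eventually.of_forall fun t => ?_)
  simp only []
  rw [← Complex.normSq_eq_norm_sq, ← Complex.mul_conj, map_sum, Finset.sum_mul_sum,
    Finset.sum_mul]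
  refine Finset.sum_congr rfl fun p _ => ?_
  rw [Finset.sum_mul]
  refine Finset.sum_congr rfl fun q _ => ?_
  rw [map_mul, ← fourier_neg, ← fourier_neg, neg_neg, neg_sub, sub_eq_add_neg, sub_eq_add_neg,
    fourier_add, fourier_add]
  ring

theorem fourierCoeff_one (n : ℤ) :
    fourierCoeff (fun _ : Freq => (1 : ℂ)) n = if n = 0 then 1 else 0 := by
  have h := congrFun (fourierCoeff_fourier (T := 2 * Real.pi) 0) n
  have h0 : (⇑(@fourier (2 * Real.pi) 0)) = fun _ => (1 : ℂ) := by ext; simp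
  rw [h0] at h
  rw [h, Pi.single_apply]

theorem fejerMean_one {N : ℕ} (hN : N ≠ 0) (x : Freq) : fejerMean (fun _ => 1) N x = 1 := by
  have hN' : (N : ℂ) ≠ 0 := by exact_mod_cast hN
  simp only [fejerMean, fourierCoeff_one, sub_eq_zero, Nat.cast_inj, ite_mul, one_mul, zero_mul]
  rw [Finset.sum_congr rfl fun p hp => by rw [Finset.sum_ite_eq, if_pos hp]]
  simp [hN']

/-- A nonnegative kernel of total mass one averages the values of g; the mass is read off from the
mean of the constant 1. -/
theorem norm_fejerMean_le {g : Freq → ℂ} (hg : Integrable g freqMeasure) {M : ℝ}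
    (hM : ∀ᵐ x ∂freqMeasure, ‖g x‖ ≤ M) (N : ℕ) (x : Freq) : ‖fejerMean g N x‖ ≤ M := by
  have hM0 : 0 ≤ M := by
    obtain ⟨y, hy⟩ := hM.exists
    exact (norm_nonneg _).trans hy
  rcases eq_or_ne N 0 with rfl | hN
  -- The mean of order 0 is an empty sum, so the bound only needs 0 ≤ M.
  · simpa [fejerMean] using hM0
  have hN' : (0 : ℝ) < N := by positivity
  set k : Freq → ℝ := fun t => ‖∑ p ∈ Finset.range N, fourier (p : ℤ) x * fourier (-(p : ℤ)) t‖ ^ 2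
    with hk
  have hkc : Continuous k := by
    refine (continuous_norm.comp (continuous_finsetSum _ fun p _ => ?_)).pow 2
    exact continuous_const.mul (map_continuous _)
  have hki : Integrable k freqMeasure := hkc.integrable_of_hasCompactSupport
    (HasCompactSupport.of_compactSpace _)
  have h1 : (N : ℝ)⁻¹ * ∫ t, k t ∂freqMeasure = 1 := by
    have := fejerMean_eq_integral (integrable_const (1 : ℂ)) N x
    rw [fejerMean_one hN] at this
    simp only [mul_one] at this
    have h2 : ∫ t, ((k t : ℝ) : ℂ) ∂freqMeasure = ((∫ t, k t ∂freqMeasure : ℝ) : ℂ) :=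
      integral_ofReal
    rw [h2] at this
    apply Complex.ofReal_injective
    rw [Complex.ofReal_mul, Complex.ofReal_inv, Complex.ofReal_natCast, Complex.ofReal_one, ← this]
  rw [fejerMean_eq_integral hg, norm_mul, norm_inv, Complex.norm_natCast]
  calc _ ≤ (N : ℝ)⁻¹ * ∫ t, k t * M ∂freqMeasure := by
        gcongr
        refine norm_integral_le_of_norm_le (hki.mul_const M) ?_
        filter_upwards [hM] with t ht
        rw [norm_mul, Complex.norm_real, Real.norm_of_nonneg (by positivity)]
        exact mul_le_mul_of_nonneg_left ht (by positivity)
    _ = M := by rw [integral_mul_const, ← mul_assoc, h1, one_mul]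

theorem fejerMean_tendstoInMeasure {g : Freq → ℂ} (hg : MemLp g 2 freqMeasure) :
    TendstoInMeasure freqMeasure (fejerMean g) atTop g := by
  set gL : Lp ℂ 2 freqMeasure := hg.toLp g
  have hS : Tendsto (fun m : ℕ => ∑ n ∈ Finset.Icc (-(m : ℤ)) m,
      fourierCoeff gL n • fourierLp (T := 2 * Real.pi) 2 n) atTop (𝓝 gL) :=
    (hasSum_fourier_series_L2 gL).comp (Finset.tendsto_Icc_neg (R := ℤ))
  have h := hS.cesaro_smul
  simp only [sum_symmetric_partial_sums] at h
  refine (tendstoInMeasure_of_tendsto_Lp h).congr (fun N => ?_) hg.coeFn_toLp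
  have hcoe (n : ℤ) : fourierCoeff gL n = fourierCoeff g n :=
    congrFun (fourierCoeff_congr_ae hg.coeFn_toLp) n
  have hsum : (N : ℝ)⁻¹ • ∑ p ∈ Finset.range N, ∑ q ∈ Finset.range N,
      fourierCoeff gL ((p : ℤ) - q) • fourierLp (T := 2 * Real.pi) 2 ((p : ℤ) - q) =
      ContinuousMap.toLp (E := ℂ) 2 freqMeasure ℂ ((N : ℂ)⁻¹ • ∑ p ∈ Finset.range N,
        ∑ q ∈ Finset.range N, fourierCoeff g ((p : ℤ) - q) • fourier ((p : ℤ) - q)) := by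
    -- The Cesàro average carries a real scalar, while the embedding into L₂ is linear over ℂ.
    have hsmul (y : Lp ℂ 2 freqMeasure) : (N : ℝ)⁻¹ • y = (N : ℂ)⁻¹ • y := by
      ext1
      filter_upwards [Lp.coeFn_smul (N : ℝ)⁻¹ y, Lp.coeFn_smul (N : ℂ)⁻¹ y] with x h1 h2
      rw [h1, h2]
      simp
    rw [hsmul, map_smul]
    simp only [map_sum, map_smul, hcoe, fourierLp]
  rw [hsum]
  refine (ContinuousMap.coeFn_toLp freqMeasure _).trans (Eventually.of_forall fun x => ?_)
  simp [fejerMean]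

/-- The weight is only integrable, so L₂ convergence is not enough. Every subsequence has a further
one converging a.e., and the uniform bound on Fejér means gives the majorant |w| (2M)² for dominated
convergence. -/
theorem tendsto_integral_fejerMean {g : Freq → ℂ} (hg : AEStronglyMeasurable g freqMeasure) {M : ℝ}
    (hM : ∀ᵐ x ∂freqMeasure, ‖g x‖ ≤ M) {w : Freq → ℝ} (hw : Integrable w freqMeasure) :
    Tendsto (fun N => ∫ x, w x * ‖g x - fejerMean g N x‖ ^ 2 ∂freqMeasure) atTop (𝓝 0) := by
  have hgi : Integrable g freqMeasure := (integrable_const M).mono' hg hM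
  have hcont (N : ℕ) : Continuous (fejerMean g N) := by
    refine continuous_const.mul (continuous_finsetSum _ fun p _ => continuous_finsetSum _ fun q _ => ?_)
    exact continuous_const.mul (map_continuous _)
  refine tendsto_of_subseq_tendsto fun ns hns => ?_
  obtain ⟨ms, -, hms⟩ := TendstoInMeasure.exists_seq_tendsto_ae
    (fun ε hε => (fejerMean_tendstoInMeasure (MemLp.of_bound hg M hM) ε hε).comp hns)
  refine ⟨ms, ?_⟩
  rw [← integral_zero Freq ℝ (μ := freqMeasure)]
  refine tendsto_integral_of_dominated_convergence (fun x => ‖w x‖ * (M + M) ^ 2)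
    (fun n => hw.aestronglyMeasurable.mul
      ((hg.sub (hcont _).aestronglyMeasurable).norm.pow 2)) (hw.norm.mul_const _) (fun n => ?_) ?_
  · filter_upwards [hM] with x hx
    rw [norm_mul, norm_pow, norm_norm]
    gcongr
    exact (norm_sub_le _ _).trans (add_le_add hx (norm_fejerMean_le hgi hM _ _))
  · filter_upwards [hms] with x hx
    have h := ((tendsto_const_nhds (x := g x)).sub hx).norm.pow 2
    simpa using (tendsto_const_nhds (x := w x)).mul h

/-! Trigonometric polynomials and membership in `L₂ˢ(W)` -/

theorem trigPoly_apply (c : ℤ →₀ (Fin T → ℂ)) (x : Freq) :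
    trigPoly c x = c.sum fun n v => fourier n x • v := rfl

theorem trigPoly_add (c d : ℤ →₀ (Fin T → ℂ)) (x : Freq) :
    trigPoly (c + d) x = trigPoly c x + trigPoly d x :=
  Finsupp.sum_add_index' (fun _ => smul_zero _) fun _ _ _ => smul_add _ _ _

theorem trigPoly_single (n : ℤ) (v : Fin T → ℂ) (x : Freq) :
    trigPoly (Finsupp.single n v) x = fourier n x • v :=
  Finsupp.sum_single_index (smul_zero _)

theorem trigPoly_finset_sum {ι : Type*} (s : Finset ι) (c : ι → ℤ →₀ (Fin T → ℂ)) (x : Freq) :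
    trigPoly (∑ i ∈ s, c i) x = ∑ i ∈ s, trigPoly (c i) x := by
  classical
  induction s using Finset.induction_on with
  | empty => simp [trigPoly_apply]
  | insert i s hi ih => rw [Finset.sum_insert hi, Finset.sum_insert hi, trigPoly_add, ih]

theorem continuous_trigPoly (c : ℤ →₀ (Fin T → ℂ)) : Continuous (trigPoly c) := by
  unfold trigPoly Finsupp.sum
  exact continuous_finsetSum _ fun n _ => by
    change Continuous fun x => fourier n x • c n
    exact (map_continuous (fourier n)).smul continuous_const

theorem aestronglyMeasurable_trigPoly (c : ℤ →₀ (Fin T → ℂ)) :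
    AEStronglyMeasurable (trigPoly c) freqMeasure :=
  (continuous_trigPoly c).aestronglyMeasurable

theorem bounded_of_continuous {v : VecFun T} (hv : Continuous v) :
    ∃ M : ℝ, ∀ x, ∑ k, ‖v x k‖ ^ 2 ≤ M := by
  have hc : Continuous fun x => ∑ k, ‖v x k‖ ^ 2 :=
    continuous_finsetSum _ fun k _ => (continuous_norm.comp ((continuous_apply k).comp hv)).pow 2
  obtain ⟨M, hM⟩ := isCompact_univ.bddAbove_image hc.continuousOn
  exact ⟨M, fun x => hM ⟨x, trivial, rfl⟩⟩

theorem energy_lt_top_of_bounded {W : MatFun T} (hW : ∀ᵐ x ∂freqMeasure, (W x).PosSemidef)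
    (hWi : ∀ k l, Integrable (fun x => W x k l) freqMeasure) {v : VecFun T}
    (hv : AEStronglyMeasurable v freqMeasure) {M : ℝ}
    (hM : ∀ᵐ x ∂freqMeasure, ∑ k, ‖v x k‖ ^ 2 ≤ M) : energy W v < ∞ :=
  energy_lt_top_of_integrable hW (integrable_sform_of_bounded hWi hv hM)

theorem energy_trigPoly_lt_top {W : MatFun T} (hW : ∀ᵐ x ∂freqMeasure, (W x).PosSemidef)
    (hWi : ∀ k l, Integrable (fun x => W x k l) freqMeasure) (c : ℤ →₀ (Fin T → ℂ)) :
    energy W (trigPoly c) < ∞ := by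
  obtain ⟨M, hM⟩ := bounded_of_continuous (continuous_trigPoly c)
  exact energy_lt_top_of_bounded hW hWi (aestronglyMeasurable_trigPoly c)
    (Eventually.of_forall hM)

/-- The coefficients of the Fejér mean of a vector function. -/
def fejerCoeff (h : VecFun T) (N : ℕ) : ℤ →₀ (Fin T → ℂ) :=
  ∑ p ∈ Finset.range N, ∑ q ∈ Finset.range N, Finsupp.single ((p : ℤ) - q)
    fun k => (N : ℂ)⁻¹ * fourierCoeff (fun x => h x k) ((p : ℤ) - q)

theorem trigPoly_fejerCoeff (h : VecFun T) (N : ℕ) (x : Freq) (k : Fin T) :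
    trigPoly (fejerCoeff h N) x k = fejerMean (fun x => h x k) N x := by
  simp only [fejerCoeff, trigPoly_finset_sum, trigPoly_single, Finset.sum_apply, Pi.smul_apply,
    smul_eq_mul, fejerMean, Finset.mul_sum]
  exact Finset.sum_congr rfl fun p _ => Finset.sum_congr rfl fun q _ => by ring

theorem mem_obsTimes_of_notMem {S : Finset ℤ} {n : ℤ} (h : n ∉ unobsTimes S) : n ∈ obsTimes S := by
  simp only [unobsTimes, Set.mem_ofPred_eq, not_or, not_le] at h
  exact ⟨h.2, h.1⟩

theorem notMem_unobsTimes {S : Finset ℤ} {n : ℤ} (h : n ∈ obsTimes S) : n ∉ unobsTimes S := by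
  rintro (h1 | h1)
  · exact h.2 h1
  · exact absurd h.1 (not_lt.2 h1)

/-- Fejér averaging only rescales Fourier coefficients and creates no new frequency. -/
theorem support_fejerCoeff {S : Finset ℤ} {h : VecFun T}
    (hcoef : ∀ n ∈ unobsTimes S, ∀ k, fourierCoeff (fun x => h x k) n = 0) (N : ℕ) :
    ((fejerCoeff h N).support : Set ℤ) ⊆ obsTimes S := by
  intro n hn
  by_contra hobs
  have hU : n ∈ unobsTimes S := by
    by_contra hU
    exact hobs (mem_obsTimes_of_notMem hU)
  refine Finsupp.mem_support_iff.1 hn ?_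
  simp only [fejerCoeff, Finsupp.finsetSum_apply]
  refine Finset.sum_eq_zero fun p _ => Finset.sum_eq_zero fun q _ => ?_
  rw [Finsupp.single_apply]
  split_ifs with hpq
  · ext k
    simp [hpq, hcoef n hU k]
  · rfl

/-- A bounded function without frequencies in `U` lies in `L₂ˢ(W)` for every spectral density. -/
theorem memL2s_of_bounded {S : Finset ℤ} {h : VecFun T} (hh : AEStronglyMeasurable h freqMeasure)
    {M : ℝ} (hM : ∀ᵐ x ∂freqMeasure, ∀ k, ‖h x k‖ ≤ M)
    (hcoef : ∀ n ∈ unobsTimes S, ∀ k, fourierCoeff (fun x => h x k) n = 0)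
    {W : MatFun T} (hW : IsSpectralDensity W) : MemL2s S W h := by
  have hMk (k : Fin T) : ∀ᵐ x ∂freqMeasure, ‖h x k‖ ≤ M := hM.mono fun x hx => hx k
  refine ⟨⟨hh, energy_lt_top_of_bounded hW.2 hW.1 hh (M := ∑ _k : Fin T, M ^ 2) ?_⟩, ?_⟩
  · filter_upwards [hM] with x hx
    exact Finset.sum_le_sum fun k _ => pow_le_pow_left₀ (norm_nonneg _) (hx k) 2
  intro ε hε
  -- A scalar weight dominating the matrix W reduces the convergence to the components of h.
  set w : Freq → ℝ := fun x => ∑ i, ∑ j, ‖W x i j‖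
  have hw : Integrable w freqMeasure := integrable_sum_norm hW.1
  have hlim : Tendsto (fun N => ENNReal.ofReal
      (∑ k, ∫ x, w x * ‖h x k - fejerMean (fun x => h x k) N x‖ ^ 2 ∂freqMeasure)) atTop (𝓝 0) := by
    have h1 := tendsto_finsetSum Finset.univ fun (k : Fin T) _ =>
      tendsto_integral_fejerMean (hh.component k) (hMk k) hw
    simpa using ENNReal.tendsto_ofReal h1
  obtain ⟨N, hN⟩ := (hlim.eventually (gt_mem_nhds hε)).exists
  refine ⟨fejerCoeff h N, support_fejerCoeff hcoef N, lt_of_le_of_lt ?_ hN⟩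
  have hi (k : Fin T) : Integrable (fun x => w x * ‖h x k - fejerMean (fun x => h x k) N x‖ ^ 2)
      freqMeasure := by
    have hg : AEStronglyMeasurable (fun x => ‖h x k - trigPoly (fejerCoeff h N) x k‖ ^ 2)
        freqMeasure :=
      ((hh.component k).sub ((aestronglyMeasurable_trigPoly _).component k)).norm.pow 2
    simp only [trigPoly_fejerCoeff] at hg
    refine hw.mul_bdd (c := (M + M) ^ 2) hg ?_
    filter_upwards [hMk k] with x hx
    rw [norm_pow, norm_norm]
    gcongr
    exact (norm_sub_le _ _).trans (add_le_add hx (norm_fejerMean_le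
      ((integrable_const M).mono' (hh.component k) (hMk k)) (hMk k) _ _))
  rw [← integral_finsetSum _ fun k _ => hi k, ofReal_integral_eq_lintegral_ofReal
    (integrable_finsetSum _ fun k _ => hi k) (Eventually.of_forall fun x =>
      Finset.sum_nonneg fun k _ => mul_nonneg (by positivity) (by positivity)), energy_eq_lintegral]
  refine lintegral_mono fun x => ENNReal.ofReal_le_ofReal ?_
  refine (Complex.re_le_norm _).trans ((norm_sform_self_le _ _).trans (le_of_eq ?_))
  rw [Finset.mul_sum]
  simp only [Pi.sub_apply, trigPoly_fejerCoeff, w]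

/-! The duality between `L₂(W⁻¹)` and `L₂(W)` -/

theorem integral_fourier (n : ℤ) :
    ∫ x : Freq, fourier n x ∂freqMeasure = if n = 0 then 1 else 0 := by
  have h := fourierCoeff_one (-n)
  simpa [fourierCoeff] using h

theorem integral_trigPoly_pairing_eq_zero {c d : ℤ →₀ (Fin T → ℂ)}
    (hcd : ∀ n ∈ c.support, n ∉ d.support) :
    ∫ x, trigPoly c x ⬝ᵥ star (trigPoly d x) ∂freqMeasure = 0 := by
  have hx (x : Freq) : trigPoly c x ⬝ᵥ star (trigPoly d x) = ∑ n ∈ c.support, ∑ m ∈ d.support,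
      fourier (n - m) x * (c n ⬝ᵥ star (d m)) := by
    simp only [trigPoly_apply, Finsupp.sum, star_sum, sum_dotProduct, dotProduct_sum]
    rw [Finset.sum_comm]
    refine Finset.sum_congr rfl fun n _ => Finset.sum_congr rfl fun m _ => ?_
    rw [star_smul, smul_dotProduct, dotProduct_smul, sub_eq_add_neg, fourier_add, fourier_neg,
      smul_eq_mul, smul_eq_mul, mul_assoc]
    rfl
  have hi (n : ℤ) (v : ℂ) : Integrable (fun x : Freq => fourier n x * v) freqMeasure :=
    ((map_continuous (fourier n)).mul continuous_const).integrable_of_hasCompactSupport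
      (HasCompactSupport.of_compactSpace _)
  simp only [hx]
  rw [integral_finsetSum _ fun n _ => integrable_finsetSum _ fun m _ => hi _ _]
  refine Finset.sum_eq_zero fun n hn => ?_
  rw [integral_finsetSum _ fun m _ => hi _ _]
  refine Finset.sum_eq_zero fun m hm => ?_
  rw [integral_mul_const, integral_fourier, if_neg, zero_mul]
  intro h
  rw [sub_eq_zero] at h
  exact hcd n hn (h ▸ hm)

/-- A spectral density that is almost everywhere invertible with integrable inverse. -/
structure IsMinimalDensity (W : MatFun T) : Prop where
  density : IsSpectralDensity W
  isUnit_det : ∀ᵐ x ∂freqMeasure, IsUnit (W x).det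
  integrable_inv : ∀ k l, Integrable (fun x => (W x)⁻¹ k l) freqMeasure

theorem IsMinimalDensity.posSemidef_inv {W : MatFun T} (hW : IsMinimalDensity W) :
    ∀ᵐ x ∂freqMeasure, ((W x)⁻¹).PosSemidef := hW.density.2.mono fun _ hx => hx.inv

theorem IsMinimalDensity.entrywiseAESM_inv {W : MatFun T} (hW : IsMinimalDensity W) :
    EntrywiseAESM fun x => (W x)⁻¹ := fun k l => (hW.integrable_inv k l).aestronglyMeasurable

theorem IsMinimalDensity.lintegral_pairing_le {W : MatFun T} (hW : IsMinimalDensity W)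
    {u g : VecFun T} (hu : AEStronglyMeasurable u freqMeasure)
    (hg : AEStronglyMeasurable g freqMeasure) :
    ∫⁻ x, ‖u x ⬝ᵥ star (g x)‖ₑ ∂freqMeasure ≤
      energy (fun x => (W x)⁻¹) u ^ (1 / 2 : ℝ) * energy W g ^ (1 / 2 : ℝ) :=
  Filtering.lintegral_pairing_le hW.density.entrywiseAESM hW.entrywiseAESM_inv hW.density.2
    hW.isUnit_det hu hg

theorem IsMinimalDensity.integrable_pairing {W : MatFun T} (hW : IsMinimalDensity W)
    {u g : VecFun T} (hu : AEStronglyMeasurable u freqMeasure)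
    (hg : AEStronglyMeasurable g freqMeasure) (hue : energy (fun x => (W x)⁻¹) u < ∞)
    (hge : energy W g < ∞) : Integrable (fun x => u x ⬝ᵥ star (g x)) freqMeasure :=
  ⟨aestronglyMeasurable_dotProduct hu (aestronglyMeasurable_star hg),
    (hW.lintegral_pairing_le hu hg).trans_lt (ENNReal.mul_lt_top
      (ENNReal.rpow_lt_top_of_nonneg (by norm_num) hue.ne)
      (ENNReal.rpow_lt_top_of_nonneg (by norm_num) hge.ne))⟩

theorem IsMinimalDensity.enorm_integral_pairing_le {W : MatFun T} (hW : IsMinimalDensity W)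
    {u g : VecFun T} (hu : AEStronglyMeasurable u freqMeasure)
    (hg : AEStronglyMeasurable g freqMeasure) :
    ‖∫ x, u x ⬝ᵥ star (g x) ∂freqMeasure‖ₑ ≤
      energy (fun x => (W x)⁻¹) u ^ (1 / 2 : ℝ) * energy W g ^ (1 / 2 : ℝ) :=
  (enorm_integral_le_lintegral_enorm _).trans (hW.lintegral_pairing_le hu hg)

/-- C is at finite distance from some polynomial of finite energy, and each of the two pieces pairs
integrably with g. -/
theorem IsMinimalDensity.integrable_pairing_limit {W : MatFun T} (hW : IsMinimalDensity W)
    {c : ℕ → ℤ →₀ (Fin T → ℂ)} {C g : VecFun T} (hC : AEStronglyMeasurable C freqMeasure)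
    (hlim : Tendsto (fun n => energy (fun x => (W x)⁻¹) (C - trigPoly (c n))) atTop (𝓝 0))
    (hg : AEStronglyMeasurable g freqMeasure) (hge : energy W g < ∞) :
    Integrable (fun x => C x ⬝ᵥ star (g x)) freqMeasure := by
  obtain ⟨n, hn⟩ := (hlim.eventually (gt_mem_nhds ENNReal.zero_lt_top)).exists
  have h1 := hW.integrable_pairing (hC.sub (aestronglyMeasurable_trigPoly (c n))) hg hn hge
  have h2 := hW.integrable_pairing (aestronglyMeasurable_trigPoly (c n)) hg
    (energy_trigPoly_lt_top hW.posSemidef_inv hW.integrable_inv _) hge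
  refine (h1.add h2).congr (Eventually.of_forall fun x => ?_)
  simp [sub_dotProduct]

theorem IsMinimalDensity.tendsto_integral_pairing {W : MatFun T} (hW : IsMinimalDensity W)
    {c : ℕ → ℤ →₀ (Fin T → ℂ)} {C g : VecFun T} (hC : AEStronglyMeasurable C freqMeasure)
    (hlim : Tendsto (fun n => energy (fun x => (W x)⁻¹) (C - trigPoly (c n))) atTop (𝓝 0))
    (hg : AEStronglyMeasurable g freqMeasure) (hge : energy W g < ∞) :
    Tendsto (fun n => ∫ x, trigPoly (c n) x ⬝ᵥ star (g x) ∂freqMeasure) atTop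
      (𝓝 (∫ x, C x ⬝ᵥ star (g x) ∂freqMeasure)) := by
  have hCi := hW.integrable_pairing_limit hC hlim hg hge
  rw [tendsto_iff_edist_tendsto_0]
  refine tendsto_of_tendsto_of_tendsto_of_le_of_le tendsto_const_nhds (h := fun n =>
    energy (fun x => (W x)⁻¹) (C - trigPoly (c n)) ^ (1 / 2 : ℝ) * energy W g ^ (1 / 2 : ℝ)) ?_
    (fun _ => zero_le) fun n => ?_
  · have h1 := hlim.ennrpow_const (1 / 2 : ℝ)
    rw [ENNReal.zero_rpow_of_pos (by norm_num)] at h1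
    simpa using ENNReal.Tendsto.mul_const h1
      (Or.inr (ENNReal.rpow_lt_top_of_nonneg (by norm_num) hge.ne).ne)
  · have h2 := hW.integrable_pairing (aestronglyMeasurable_trigPoly (c n)) hg
      (energy_trigPoly_lt_top hW.posSemidef_inv hW.integrable_inv _) hge
    simp only []
    rw [edist_comm, edist_eq_enorm_sub, ← integral_sub hCi h2]
    refine le_trans (le_of_eq ?_)
      (hW.enorm_integral_pairing_le (hC.sub (aestronglyMeasurable_trigPoly (c n))) hg)
    simp [sub_dotProduct]

/-- Subtracting from g an approximating polynomial in observed frequencies leaves the integral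
unchanged, since its frequencies are disjoint from those of c; what remains is as small as the
approximation error. -/
theorem IsMinimalDensity.integral_trigPoly_pairing_memL2s {W : MatFun T}
    (hW : IsMinimalDensity W) {S : Finset ℤ} {c : ℤ →₀ (Fin T → ℂ)}
    (hc : (c.support : Set ℤ) ⊆ unobsTimes S) {g : VecFun T} (hg : MemL2s S W g) :
    ∫ x, trigPoly c x ⬝ᵥ star (g x) ∂freqMeasure = 0 := by
  have hce := energy_trigPoly_lt_top hW.posSemidef_inv hW.integrable_inv c
  have hcm := aestronglyMeasurable_trigPoly c
  rw [← enorm_eq_zero]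
  refine nonpos_iff_eq_zero.1 ?_
  have hlim : Tendsto (fun m : ℕ => energy (fun x => (W x)⁻¹) (trigPoly c) ^ (1 / 2 : ℝ) *
      ((m : ℝ≥0∞)⁻¹) ^ (1 / 2 : ℝ)) atTop (𝓝 0) := by
    have h1 := ENNReal.tendsto_inv_nat_nhds_zero.ennrpow_const (1 / 2 : ℝ)
    rw [ENNReal.zero_rpow_of_pos (by norm_num)] at h1
    simpa using ENNReal.Tendsto.const_mul h1
      (Or.inr (ENNReal.rpow_lt_top_of_nonneg (by norm_num : (0 : ℝ) ≤ 1 / 2) hce.ne).ne)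
  refine ge_of_tendsto' hlim fun m => ?_
  obtain ⟨d, hd, hgd⟩ := hg.2 (m : ℝ≥0∞)⁻¹ (by simp)
  have hdm := aestronglyMeasurable_trigPoly d
  have h1 := hW.integrable_pairing hcm hg.1.1 hce hg.1.2
  have h2 := hW.integrable_pairing hcm hdm hce
    (energy_trigPoly_lt_top hW.density.2 hW.density.1 d)
  have h3 : ∫ x, trigPoly c x ⬝ᵥ star (g x) ∂freqMeasure =
      ∫ x, trigPoly c x ⬝ᵥ star ((g - trigPoly d) x) ∂freqMeasure := by
    simp only [Pi.sub_apply, star_sub, dotProduct_sub]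
    rw [integral_sub h1 h2, integral_trigPoly_pairing_eq_zero, sub_zero]
    exact fun n hn hn' => notMem_unobsTimes (hd hn') (hc hn)
  rw [h3]
  refine (hW.enorm_integral_pairing_le hcm (hg.1.1.sub hdm)).trans ?_
  gcongr

/-- The functions in `L₂(W⁻¹)` with frequencies in `U` annihilate `L₂ˢ(W)`. -/
theorem IsMinimalDensity.integral_pairing_memL2s {W : MatFun T} (hW : IsMinimalDensity W)
    {S : Finset ℤ} {c : ℕ → ℤ →₀ (Fin T → ℂ)} {C g : VecFun T}
    (hC : AEStronglyMeasurable C freqMeasure)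
    (hc : ∀ n, ((c n).support : Set ℤ) ⊆ unobsTimes S)
    (hlim : Tendsto (fun n => energy (fun x => (W x)⁻¹) (C - trigPoly (c n))) atTop (𝓝 0))
    (hg : MemL2s S W g) : ∫ x, C x ⬝ᵥ star (g x) ∂freqMeasure = 0 := by
  have h := hW.tendsto_integral_pairing hC hlim hg.1.1 hg.1.2
  simp only [hW.integral_trigPoly_pairing_memL2s (hc _) hg] at h
  exact tendsto_nhds_unique h tendsto_const_nhds

/-! Integrability of `F (F + G)⁻¹` and the operators as Fourier coefficients -/

theorem Minimality.isMinimalDensity {F G : MatFun T} (h : Minimality F G)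
    (hF : IsSpectralDensity F) (hG : IsSpectralDensity G) : IsMinimalDensity (F + G) :=
  ⟨hF.add hG, h.1, h.2⟩

/-- The function `x ↦ conj (exp (-i k λ) W(λ)⁻¹ δ_m)`. Pairing with it gives Fourier coefficients. -/
def invColumn (W : MatFun T) (k : ℤ) (m : Fin T) : VecFun T :=
  fun x => star (fourier (-k) x • fun i => (W x)⁻¹ i m)

/-- W sends column m of W⁻¹ to the unit vector δ_m, so the form collapses to a diagonal entry of
W⁻¹. Minimality therefore puts `invColumn` in L₂(W). -/
theorem sform_invColumn {W : Matrix (Fin T) (Fin T) ℂ} (hu : IsUnit W.det) (z : ℂ) (m : Fin T) :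
    sform W (star (z • fun i => W⁻¹ i m)) (star (z • fun i => W⁻¹ i m)) =
      star z * z * star (W⁻¹ m m) := by
  have h : W *ᵥ (fun i => W⁻¹ i m) = Pi.single m 1 := by
    ext i
    have := congrFun (congrFun (Matrix.mul_nonsing_inv _ hu) i) m
    rw [Matrix.mul_apply] at this
    rw [Matrix.mulVec, dotProduct, this, Matrix.one_apply, Pi.single_apply]
  rw [sform, star_star, Matrix.mulVec_smul, h, dotProduct_smul, dotProduct_single_one]
  simp
  ring

theorem norm_fourier_apply (n : ℤ) (x : Freq) : ‖fourier n x‖ = 1 := by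
  rw [fourier_apply]; exact Circle.norm_coe _

theorem IsMinimalDensity.aestronglyMeasurable_invColumn {W : MatFun T} (hW : IsMinimalDensity W)
    (k : ℤ) (m : Fin T) : AEStronglyMeasurable (invColumn W k m) freqMeasure :=
  aestronglyMeasurable_star ((map_continuous (fourier (-k))).aestronglyMeasurable.smul
    (aestronglyMeasurable_vecFun fun i => hW.entrywiseAESM_inv i m))

theorem IsMinimalDensity.energy_invColumn_lt_top {W : MatFun T} (hW : IsMinimalDensity W)
    (k : ℤ) (m : Fin T) : energy W (invColumn W k m) < ∞ := by
  refine energy_lt_top_of_integrable hW.density.2 ?_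
  refine (hW.integrable_inv m m).re.congr ?_
  filter_upwards [hW.isUnit_det] with x hx
  rw [invColumn, sform_invColumn hx]
  have h : star (fourier (-k) x) * fourier (-k) x = 1 := by
    have := Complex.conj_mul' (fourier (-k) x)
    rw [norm_fourier_apply] at this
    simpa using this
  rw [h]
  simp

theorem dotProduct_star_invColumn (W : MatFun T) (k : ℤ) (m : Fin T) (u : Fin T → ℂ) (x : Freq) :
    u ⬝ᵥ star (invColumn W k m x) = fourier (-k) x • (u ᵥ* (W x)⁻¹) m := by
  rw [invColumn, star_star, dotProduct_smul]
  rfl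

/-- The (i, j) entry is the F-form of δ_i against g, the conjugate of column j of (F + G)⁻¹.
Cauchy–Schwarz bounds its square by F_ii times the F-form of g, and the latter is at most the (F +
G)-form of g, which is the (j, j) entry of the inverse. -/
theorem integrable_mul_inv {F G : MatFun T} (hF : IsSpectralDensity F) (hG : IsSpectralDensity G)
    (hmin : Minimality F G) (i j : Fin T) :
    Integrable (fun x => (F x * (F x + G x)⁻¹) i j) freqMeasure := by
  have hW := hmin.isMinimalDensity hF hG
  refine Integrable.mono' ((hF.1 i i).norm.add (hmin.2 j j).norm)
    (hF.entrywiseAESM.mul hW.entrywiseAESM_inv i j) ?_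
  filter_upwards [hF.2, hG.2, hmin.1] with x h1 h2 h3
  set g : Fin T → ℂ := star ((1 : ℂ) • fun l => (F x + G x)⁻¹ l j) with hg
  have ha : (F x * (F x + G x)⁻¹) i j = sform (F x) (Pi.single i 1) g := by
    rw [sform, single_one_dotProduct, hg, star_star, one_smul, Matrix.mul_apply]
    rfl
  have hb : (sform (F x) (Pi.single i 1) (Pi.single i 1)).re = (F x i i).re := by
    simp [sform]
  have hc : (sform (F x) g g).re ≤ ((F x + G x)⁻¹ j j).re := by
    have h := sform_invColumn h3 1 j
    rw [← hg, sform_add_weight] at h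
    have h' := congrArg Complex.re h
    simp only [Complex.add_re, star_one, one_mul] at h'
    have := sform_self_nonneg h2 g
    simp at h'
    linarith
  have hd := norm_sform_sq_le h1 (Pi.single i 1) g
  have he := sform_self_nonneg h1 (Pi.single i 1)
  have hf := sform_self_nonneg h1 g
  rw [ha]
  -- A geometric mean is at most the sum, which turns the product into integrable terms.
  have hsum : ‖sform (F x) (Pi.single i 1) g‖ ≤
      (sform (F x) (Pi.single i 1) (Pi.single i 1)).re + (sform (F x) g g).re := by
    refine abs_le_of_sq_le_sq' ?_ (by positivity) |>.2
    nlinarith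
  simp only [Pi.add_apply]
  linarith [Complex.re_le_norm (F x i i), Complex.re_le_norm ((F x + G x)⁻¹ j j)]

theorem summable_norm_coeff {S : Finset ℤ} {a : ℕ → Fin T → ℂ}
    (ha : Summable fun j : ZS S => ∑ k, ‖a j k‖) : Summable fun j : ZS S => ‖a j‖ :=
  Summable.of_nonneg_of_le (fun _ => norm_nonneg _)
    (fun _ => (pi_norm_le_iff_of_nonneg (Finset.sum_nonneg fun _ _ => norm_nonneg _)).2 fun i =>
      Finset.single_le_sum (f := fun k => ‖a _ k‖) (fun _ _ => norm_nonneg _) (Finset.mem_univ i)) ha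

theorem hasSum_funcA {S : Finset ℤ} {a : ℕ → Fin T → ℂ}
    (ha : Summable fun j : ZS S => ∑ k, ‖a j k‖) (x : Freq) :
    HasSum (fun j : ZS S => fourier (-((j : ℕ) : ℤ)) x • a j) (funcA S a x) := by
  refine Summable.hasSum (Summable.of_norm ((summable_norm_coeff ha).congr fun j => ?_))
  rw [norm_smul, norm_fourier_apply, one_mul]

theorem continuous_funcA {S : Finset ℤ} {a : ℕ → Fin T → ℂ}
    (ha : Summable fun j : ZS S => ∑ k, ‖a j k‖) : Continuous (funcA S a) :=
  continuous_tsum (fun j => (map_continuous (fourier (-((j : ℕ) : ℤ)))).smul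
    (continuous_const (y := a j))) (summable_norm_coeff ha) fun j x => by
      change ‖fourier (-((j : ℕ) : ℤ)) x • a j‖ ≤ _
      rw [norm_smul, norm_fourier_apply, one_mul]

/-- Absolute summability of the a(j) allows sum and integral to be exchanged; the factor exp(-ijλ)
of A shifts the index k to k + j. -/
theorem hasSum_opR {S : Finset ℤ} {a : ℕ → Fin T → ℂ}
    (ha : Summable fun j : ZS S => ∑ k, ‖a j k‖) {M : MatFun T}
    (hM : ∀ i j, Integrable (fun x => M x i j) freqMeasure) (k : ℤ) (m : Fin T) :
    HasSum (fun j : ZS S => (a j ᵥ* matCoeff M (k + (j : ℕ))) m)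
      (fourierCoeff (fun x => (funcA S a x ᵥ* M x) m) k) := by
  set f : ZS S → Freq → ℂ := fun j x =>
    fourier (-k) x * ((fourier (-((j : ℕ) : ℤ)) x • a j) ᵥ* M x) m with hf
  have hterm (j : ZS S) (x : Freq) :
      f j x = ∑ i, a j i * (fourier (-(k + (j : ℕ))) x • M x i m) := by
    simp only [hf, Matrix.vecMul, dotProduct, Finset.mul_sum, Pi.smul_apply, smul_eq_mul]
    refine Finset.sum_congr rfl fun i _ => ?_
    rw [neg_add, fourier_add]
    ring
  have hi (j : ZS S) (i : Fin T) :
      Integrable (fun x => a j i * (fourier (-(k + (j : ℕ))) x • M x i m)) freqMeasure :=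
    ((hM i m).fourier_smul _).const_mul _
  have hfi (j : ZS S) : Integrable (f j) freqMeasure := by
    rw [show f j = _ from funext (hterm j)]
    exact integrable_finsetSum _ fun i _ => hi j i
  have hint (j : ZS S) : ∫ x, f j x ∂freqMeasure = (a j ᵥ* matCoeff M (k + (j : ℕ))) m := by
    simp only [hterm]
    rw [integral_finsetSum _ fun i _ => hi j i]
    simp only [integral_const_mul]
    rfl
  have hsum : Summable fun j : ZS S => ∫ x, ‖f j x‖ ∂freqMeasure := by
    refine Summable.of_nonneg_of_le (fun j => integral_nonneg fun x => norm_nonneg _) (fun j => ?_)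
      (ha.mul_right (∑ i, ∫ x, ‖M x i m‖ ∂freqMeasure))
    calc ∫ x, ‖f j x‖ ∂freqMeasure
        ≤ ∫ x, (∑ k, ‖a j k‖) * ∑ i, ‖M x i m‖ ∂freqMeasure := by
          refine integral_mono (hfi j).norm
            ((integrable_finsetSum _ fun i _ => (hM i m).norm).const_mul _) fun x => ?_
          simp only [hterm]
          refine (norm_sum_le _ _).trans ?_
          rw [Finset.mul_sum]
          refine Finset.sum_le_sum fun i _ => ?_
          rw [norm_mul, norm_smul, norm_fourier_apply, one_mul]
          gcongr
          exact Finset.single_le_sum (f := fun k => ‖a j k‖) (fun _ _ => norm_nonneg _)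
            (Finset.mem_univ i)
      _ = _ := by rw [integral_const_mul, integral_finsetSum _ fun i _ => (hM i m).norm]
  have key := hasSum_integral_of_summable_integral_norm hfi hsum
  simp only [hint] at key
  have heq : fourierCoeff (fun x => (funcA S a x ᵥ* M x) m) k =
      ∫ x, ∑' j, f j x ∂freqMeasure := by
    refine integral_congr_ae (Eventually.of_forall fun x => ?_)
    have h1 := (hasSum_funcA ha x).map (Matrix.vecMulLinear (M x)).toAddMonoidHom
      (LinearMap.continuous_of_finiteDimensional (Matrix.vecMulLinear (M x)))
    exact (((Pi.hasSum.1 h1) m).mul_left (fourier (-k) x)).tsum_eq.symm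
  rw [heq]
  exact key

theorem opR_apply {S : Finset ℤ} {a : ℕ → Fin T → ℂ}
    (ha : Summable fun j : ZS S => ∑ k, ‖a j k‖) {F G : MatFun T} (hF : IsSpectralDensity F)
    (hG : IsSpectralDensity G) (hmin : Minimality F G) (k : ℤ) (m : Fin T) :
    opR S a F G k m =
      fourierCoeff (fun x => (funcA S a x ᵥ* (F x * (F x + G x)⁻¹)) m) k :=
  congrFun (Pi.hasSum.2 fun m => hasSum_opR ha (integrable_mul_inv hF hG hmin) k m).tsum_eq m

theorem opB_apply {F G : MatFun T} (hmin : Minimality F G) (c : ℤ →₀ (Fin T → ℂ)) (k : ℤ)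
    (m : Fin T) :
    opB F G c k m = ∫ x, trigPoly c x ⬝ᵥ star (invColumn (F + G) k m x) ∂freqMeasure := by
  have hx (x : Freq) : trigPoly c x ⬝ᵥ star (invColumn (F + G) k m x) =
      ∑ j ∈ c.support, ∑ i, c j i * (fourier (-(k - j)) x • (F x + G x)⁻¹ i m) := by
    rw [invColumn, star_star, trigPoly_apply, Finsupp.sum, sum_dotProduct]
    refine Finset.sum_congr rfl fun j _ => ?_
    rw [dotProduct]
    refine Finset.sum_congr rfl fun i _ => ?_
    rw [neg_sub, sub_eq_add_neg, fourier_add]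
    simp only [Pi.smul_apply, Pi.add_apply, smul_eq_mul]
    ring
  have hi (j : ℤ) (i : Fin T) : Integrable
      (fun x => c j i * (fourier (-(k - j)) x • (F x + G x)⁻¹ i m)) freqMeasure :=
    ((hmin.2 i m).fourier_smul _).const_mul _
  simp only [hx]
  rw [integral_finsetSum _ fun j _ => integrable_finsetSum _ fun i _ => hi j i, opB, Finsupp.sum,
    Finset.sum_apply]
  refine Finset.sum_congr rfl fun j _ => ?_
  rw [integral_finsetSum _ fun i _ => hi j i]
  simp only [integral_const_mul]
  rfl

/-- The spectral characteristic has no frequencies in `U`. -/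
theorem fourierCoeff_specChar {S : Finset ℤ} {a : ℕ → Fin T → ℂ}
    (ha : Summable fun j : ZS S => ∑ k, ‖a j k‖) {F G : MatFun T} (hF : IsSpectralDensity F)
    (hG : IsSpectralDensity G) (hmin : Minimality F G) {C : VecFun T}
    (hC : IsInverseSeries S a F G C) {k : ℤ} (hk : k ∈ unobsTimes S) (m : Fin T) :
    fourierCoeff (fun x => specChar S a F G C x m) k = 0 := by
  obtain ⟨c, hCm, hc, hlim, hB⟩ := hC
  have hW := hmin.isMinimalDensity hF hG
  have hgm := hW.aestronglyMeasurable_invColumn k m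
  have hge := hW.energy_invColumn_lt_top k m
  have h1 := hW.tendsto_integral_pairing hCm hlim hgm hge
  simp only [← opB_apply hmin] at h1
  -- (B cₙ)(k) tends both to (R a)(k) and to the k-th Fourier coefficient of Cᵀ (F + G)⁻¹, so these
  -- agree on U.
  have h2 := tendsto_nhds_unique ((tendsto_pi_nhds.1 (hB k hk)) m) h1
  rw [opR_apply ha hF hG hmin] at h2
  have hCi := hW.integrable_pairing_limit hCm hlim hgm hge
  simp only [dotProduct_star_invColumn] at h2 hCi
  obtain ⟨M, hM⟩ := bounded_of_continuous (continuous_funcA ha)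
  have hAi : Integrable (fun x => (funcA S a x ᵥ* (F x * (F x + G x)⁻¹)) m) freqMeasure := by
    simp only [Matrix.vecMul, dotProduct]
    refine integrable_finsetSum _ fun i _ => ?_
    refine (integrable_mul_inv hF hG hmin i m).bdd_mul (c := M + 1)
      ((continuous_apply i).comp (continuous_funcA ha)).aestronglyMeasurable
      (Eventually.of_forall fun x => ?_)
    have h3 : ‖funcA S a x i‖ ^ 2 ≤ M := (Finset.single_le_sum (f := fun k => ‖funcA S a x k‖ ^ 2)
      (fun _ _ => by positivity) (Finset.mem_univ i)).trans (hM x)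
    nlinarith [sq_nonneg (‖funcA S a x i‖ - 1)]
  have h3 : fourierCoeff (fun x => specChar S a F G C x m) k =
      fourierCoeff (fun x => (funcA S a x ᵥ* (F x * (F x + G x)⁻¹)) m) k -
        ∫ x, fourier (-k) x • (C x ᵥ* ((F + G) x)⁻¹) m ∂freqMeasure := by
    rw [fourierCoeff, fourierCoeff, ← integral_sub (hAi.fourier_smul _) hCi]
    refine integral_congr_ae (Eventually.of_forall fun x => ?_)
    simp [specChar, mul_sub]
  rw [h3, h2, sub_self]

/-! The optimal estimate -/

theorem funcA_sub_specChar {S : Finset ℤ} {a : ℕ → Fin T → ℂ} {F G : MatFun T} {C : VecFun T}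
    {x : Freq} (hx : IsUnit (F x + G x).det) :
    funcA S a x - specChar S a F G C x =
      (funcA S a x ᵥ* G x + C x) ᵥ* (F x + G x)⁻¹ := by
  have h : funcA S a x = funcA S a x ᵥ* (F x * (F x + G x)⁻¹) +
      funcA S a x ᵥ* (G x * (F x + G x)⁻¹) := by
    rw [← Matrix.vecMul_add, ← Matrix.add_mul, Matrix.mul_nonsing_inv _ hx, Matrix.vecMul_one]
  rw [specChar, Matrix.add_vecMul, Matrix.vecMul_vecMul]
  nth_rw 1 [h]
  abel

/-- Normal equation: hᵀ (F + G) = Aᵀ F - Cᵀ, so the first variation of the error at h is the pairing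
with C. -/
theorem sform_specChar {S : Finset ℤ} {a : ℕ → Fin T → ℂ} {F G : MatFun T} {C : VecFun T}
    {x : Freq} (hx : IsUnit (F x + G x).det) (d : Fin T → ℂ) :
    sform (F x) (funcA S a x - specChar S a F G C x) d - sform (G x) (specChar S a F G C x) d =
      C x ⬝ᵥ star d := by
  have h : specChar S a F G C x ᵥ* (F x + G x) = funcA S a x ᵥ* F x - C x := by
    rw [specChar, Matrix.sub_vecMul, Matrix.vecMul_vecMul, Matrix.vecMul_vecMul, Matrix.mul_assoc,
      Matrix.nonsing_inv_mul _ hx, Matrix.mul_one, Matrix.vecMul_one]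
  rw [sform_sub_left, sub_sub, ← sform_add_weight, sform, sform, Matrix.dotProduct_mulVec,
    Matrix.dotProduct_mulVec, h, sub_dotProduct]
  ring

theorem MemL2s.sub {S : Finset ℤ} {W : MatFun T} (hW : IsSpectralDensity W) {g h : VecFun T}
    (hg : MemL2s S W g) (hh : MemL2s S W h) : MemL2s S W (g - h) := by
  refine ⟨⟨hg.1.1.sub hh.1.1, ?_⟩, fun ε hε => ?_⟩
  · rw [sub_eq_add_neg]
    refine (energy_add_le hW.entrywiseAESM hW.2 hg.1.1).trans_lt ?_
    rw [energy_neg]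
    exact ENNReal.add_lt_top.2 ⟨ENNReal.mul_lt_top (by simp) hg.1.2,
      ENNReal.mul_lt_top (by simp) hh.1.2⟩
  · have hε4 : 0 < ε / 4 := ENNReal.div_pos hε.ne' (by simp)
    obtain ⟨c, hc, hgc⟩ := hg.2 _ hε4
    obtain ⟨d, hd, hhd⟩ := hh.2 _ hε4
    refine ⟨c - d, fun n hn => ?_, ?_⟩
    · by_cases hcn : n ∈ c.support
      · exact hc hcn
      · refine hd (Finsupp.mem_support_iff.2 fun h0 => Finsupp.mem_support_iff.1 hn ?_)
        rw [Finsupp.sub_apply, h0, Finsupp.notMem_support_iff.1 hcn, sub_zero]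
    · have h1 : g - h - trigPoly (c - d) = (g - trigPoly c) + -(h - trigPoly d) := by
        funext x
        have h2 : trigPoly c x = trigPoly (c - d) x + trigPoly d x := by
          rw [← trigPoly_add, sub_add_cancel]
        simp only [Pi.sub_apply, Pi.add_apply, Pi.neg_apply, h2]
        abel
      rw [h1]
      refine (energy_add_le hW.entrywiseAESM hW.2
        (hg.1.1.sub (aestronglyMeasurable_trigPoly c))).trans_lt ?_
      rw [energy_neg]
      calc _ < 2 * (ε / 4) + 2 * (ε / 4) := by
            refine ENNReal.add_lt_add ?_ ?_ <;>
            exact (ENNReal.mul_lt_mul_iff_right (by simp) (by simp)).2 (by assumption)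
        _ = ε := by
            rw [← add_mul, div_eq_mul_inv, mul_comm ε, ← mul_assoc]
            norm_num
            rw [ENNReal.mul_inv_cancel (by simp) (by simp), one_mul]

/-- The Pythagorean identity for a bounded spectral characteristic. -/
theorem mse_eq_add_energy {S : Finset ℤ} {a : ℕ → Fin T → ℂ}
    {F G : MatFun T} (hF : IsSpectralDensity F)
    (hG : IsSpectralDensity G) (hmin : Minimality F G) {C : VecFun T}
    (hC : IsInverseSeries S a F G C)
    (hFi : Integrable (fun x => (sform (F x) (funcA S a x - specChar S a F G C x)
      (funcA S a x - specChar S a F G C x)).re) freqMeasure)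
    (hGi : Integrable (fun x => (sform (G x) (specChar S a F G C x)
      (specChar S a F G C x)).re) freqMeasure)
    (hh : MemL2s S (F + G) (specChar S a F G C)) {g : VecFun T} (hg : MemL2s S (F + G) g) :
    mse S a g F G = mse S a (specChar S a F G C) F G + energy (F + G) (g - specChar S a F G C) := by
  have hW := hmin.isMinimalDensity hF hG
  set h := specChar S a F G C with hdef
  set d : VecFun T := g - h with hd
  have hdm : MemL2s S (F + G) d := hg.sub hW.density hh
  obtain ⟨c, hCm, hc, hlim, -⟩ := hC
  have hpi := hW.integrable_pairing_limit hCm hlim hdm.1.1 hdm.1.2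
  have hp0 := hW.integral_pairing_memL2s hCm hc hlim hdm
  have hp0' : ∫ x, (C x ⬝ᵥ star (d x)).re ∂freqMeasure = 0 := by
    have := integral_re hpi
    rw [hp0] at this
    simpa using this
  have hdi := integrable_of_energy_lt_top hW.density.entrywiseAESM hW.density.2 hdm.1.1 hdm.1.2
  have hpt : ∀ᵐ x ∂freqMeasure,
      (sform (F x) (funcA S a x - g x) (funcA S a x - g x)).re + (sform (G x) (g x) (g x)).re =
        (sform (F x) (funcA S a x - h x) (funcA S a x - h x)).re + (sform (G x) (h x) (h x)).re +
          (sform ((F + G) x) (d x) (d x)).re - 2 * (C x ⬝ᵥ star (d x)).re := by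
    filter_upwards [hF.2, hG.2, hmin.1] with x h1 h2 h3
    have h4 := sform_error_expansion h1.isHermitian h2.isHermitian (funcA S a x - h x) (h x) (d x)
    rw [hdef, sform_specChar h3, ← hdef] at h4
    have e1 : funcA S a x - h x - d x = funcA S a x - g x := by simp [hd]
    have e2 : h x + d x = g x := by simp [hd]
    rw [e1, e2] at h4
    exact h4
  have hsplit (v : VecFun T) (hv : AEStronglyMeasurable v freqMeasure) : mse S a v F G =
      ∫⁻ x, ENNReal.ofReal ((sform (F x) (funcA S a x - v x) (funcA S a x - v x)).re +
        (sform (G x) (v x) (v x)).re) ∂freqMeasure := by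
    rw [mse, energy_eq_lintegral, energy_eq_lintegral, ← lintegral_add_right'
      _ (hG.entrywiseAESM.sform_re hv hv).aemeasurable.ennreal_ofReal]
    refine lintegral_congr_ae ?_
    filter_upwards [hF.2, hG.2] with x h1 h2
    rw [ENNReal.ofReal_add (sform_self_nonneg h1 _) (sform_self_nonneg h2 _)]
    rfl
  -- Integrability of the error density of g is inferred from the expansion, all of whose terms are
  -- integrable.
  have hRi := ((hFi.add hGi).add hdi).sub (hpi.re.const_mul 2)
  have hnn : ∀ᵐ x ∂freqMeasure, 0 ≤ (sform (F x) (funcA S a x - g x) (funcA S a x - g x)).re +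
      (sform (G x) (g x) (g x)).re := by
    filter_upwards [hF.2, hG.2] with x h1 h2
    exact add_nonneg (sform_self_nonneg h1 _) (sform_self_nonneg h2 _)
  have hnn2 : ∀ᵐ x ∂freqMeasure, 0 ≤ (sform (F x) (funcA S a x - h x) (funcA S a x - h x)).re +
      (sform (G x) (h x) (h x)).re := by
    filter_upwards [hF.2, hG.2] with x h1 h2
    exact add_nonneg (sform_self_nonneg h1 _) (sform_self_nonneg h2 _)
  have hsumi : Integrable (fun x => (sform (F x) (funcA S a x - h x) (funcA S a x - h x)).re +
      (sform (G x) (h x) (h x)).re) freqMeasure := hFi.add hGi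
  rw [hsplit g hg.1.1, hsplit h hh.1.1,
    ← ofReal_integral_eq_lintegral_ofReal (hRi.congr (hpt.mono fun x hx => hx.symm)) hnn,
    ← ofReal_integral_eq_lintegral_ofReal hsumi hnn2,
    energy_eq_ofReal_integral hW.density.2 hdi,
    ← ENNReal.ofReal_add (integral_nonneg_of_ae hnn2)
      (integral_nonneg_of_ae (ae_sform_nonneg hW.density.2 d)), integral_congr_ae hpt]
  congr 1
  calc _ = ∫ x, (((sform (F x) (funcA S a x - h x) (funcA S a x - h x)).re +
          (sform (G x) (h x) (h x)).re) + (sform ((F + G) x) (d x) (d x)).re) ∂freqMeasure -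
          ∫ x, 2 * (C x ⬝ᵥ star (d x)).re ∂freqMeasure :=
        integral_sub (hsumi.add hdi) (hpi.re.const_mul 2)
    _ = _ := by
        rw [integral_const_mul, hp0', mul_zero, sub_zero]
        exact integral_add hsumi hdi

/-- The duality inequality with u = g = v bounds |v|⁴ by a product with a zero factor; invertibility
of W enters here. -/
theorem ae_eq_zero_of_energy_eq_zero {W : MatFun T} (hW : IsMinimalDensity W) {v : VecFun T}
    (hv : AEStronglyMeasurable v freqMeasure) (h : energy W v = 0) : v =ᵐ[freqMeasure] 0 := by
  rw [energy_eq_lintegral, lintegral_eq_zero_iff'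
    (hW.density.entrywiseAESM.sform_re hv hv).aemeasurable.ennreal_ofReal] at h
  filter_upwards [h, hW.density.2, hW.isUnit_det] with x h1 h2 h3
  have h4 : (sform (W x) (v x) (v x)).re ≤ 0 := ENNReal.ofReal_eq_zero.1 h1
  have h5 := norm_dotProduct_star_sq_le_inv h2 h3 (v x) (v x)
  have h6 := sform_self_nonneg h2 (v x)
  rw [le_antisymm h4 h6, mul_zero] at h5
  have h7 : v x ⬝ᵥ star (v x) = 0 := by
    rw [← norm_eq_zero]; exact pow_eq_zero_iff (two_ne_zero) |>.1 (le_antisymm h5 (sq_nonneg _))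
  exact dotProduct_self_star_eq_zero.1 h7

/-! The saddle point -/

/-- The relation determines a constant matrix of Lagrange multipliers, on which the moments of all
the densities of the class agree. -/
theorem ClassData.exists_multiplier {S : Finset ℤ} {a : ℕ → Fin T → ℂ} {F G : MatFun T}
    {C : VecFun T} {K : ClassData T} (h : K.relation S a F G C) :
    ∃ M : Matrix (Fin T) (Fin T) ℂ,
      (∀ᵐ x ∂freqMeasure, gramG S a G C x = (F x + G x) * M * (F x + G x)) ∧
      ∃ v : ℂ, ∀ F' ∈ K.densities, ∫ x, ∑ i, ∑ j, F' x i j * M j i ∂freqMeasure = v := by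
  cases K with
  | trace p =>
    obtain ⟨α, hα⟩ := h
    refine ⟨((α : ℂ) ^ 2) • 1, hα.mono fun x hx => by
      rw [hx, Matrix.mul_smul, Matrix.mul_one, Matrix.smul_mul, sq (F x + G x)],
      (α : ℂ) ^ 2 * p, fun F' hF' => ?_⟩
    have h2 : ∫ x, (F' x).trace ∂freqMeasure = (p : ℂ) := hF'.2
    rw [← h2, ← integral_const_mul]
    refine integral_congr_ae (Eventually.of_forall fun x => ?_)
    simp [Matrix.one_apply, Matrix.trace, Finset.mul_sum, mul_comm]
  | diag p =>
    obtain ⟨α, hα⟩ := h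
    refine ⟨_, hα, ∑ k, p k * (α k : ℂ) ^ 2, fun F' hF' => ?_⟩
    have h2 : ∀ k, ∫ x, F' x k k ∂freqMeasure = (p k : ℂ) := hF'.2
    simp only [Matrix.diagonal_apply, mul_ite, mul_zero, Finset.sum_ite_eq', Finset.mem_univ,
      if_true]
    rw [integral_finsetSum _ fun k _ => (hF'.1.1 k k).mul_const _]
    simp only [integral_mul_const, h2]
  | weighted B₁ hB p =>
    obtain ⟨α, hα⟩ := h
    -- The transpose in the relation cancels the one in tr(F M), which leaves α² ⟨B₁, F⟩.
    refine ⟨((α : ℂ) ^ 2) • B₁ᵀ, hα.mono fun x hx => by rw [hx]; simp,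
      (α : ℂ) ^ 2 * p, fun F' hF' => ?_⟩
    have h2 : ∫ x, (∑ k, ∑ l, B₁ k l * F' x k l) ∂freqMeasure = (p : ℂ) := hF'.2
    rw [← h2, ← integral_const_mul]
    refine integral_congr_ae (Eventually.of_forall fun x => ?_)
    simp only [Finset.mul_sum]
    refine Finset.sum_congr rfl fun i _ => Finset.sum_congr rfl fun j _ => ?_
    simp only [Matrix.smul_apply, Matrix.transpose_apply, smul_eq_mul]
    ring
  | full P hP =>
    obtain ⟨α, hα⟩ := h
    refine ⟨_, hα, ∑ i, ∑ j, P i j * Matrix.vecMulVec α (star α) j i, fun F' hF' => ?_⟩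
    have h2 : ∀ k l, ∫ x, F' x k l ∂freqMeasure = P k l := hF'.2
    have hi (i j : Fin T) : Integrable (fun x => F' x i j * Matrix.vecMulVec α (star α) j i)
      freqMeasure := (hF'.1.1 i j).mul_const _
    rw [integral_finsetSum _ fun i _ => integrable_finsetSum _ fun j _ => hi i j]
    refine Finset.sum_congr rfl fun i _ => ?_
    rw [integral_finsetSum _ fun j _ => hi i j]
    simp only [integral_mul_const, h2]

/-- The Gram matrix of the residual of the estimate is the multiplier matrix. -/
theorem gram_residual {S : Finset ℤ} {a : ℕ → Fin T → ℂ} {F G : MatFun T} {C : VecFun T}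
    {M : Matrix (Fin T) (Fin T) ℂ} {x : Freq} (hH : (F x + G x).IsHermitian)
    (hx : IsUnit (F x + G x).det)
    (hM : gramG S a G C x = (F x + G x) * M * (F x + G x)) (i j : Fin T) :
    star ((funcA S a x - specChar S a F G C x) i) * (funcA S a x - specChar S a F G C x) j =
      M i j := by
  have h : Matrix.vecMulVec (star (funcA S a x - specChar S a F G C x))
      (funcA S a x - specChar S a F G C x) = M := by
    -- With residual N (F + G)⁻¹ and F + G Hermitian, the Gram matrix is N*N between two copies of
    -- (F + G)⁻¹.
    rw [funcA_sub_specChar hx, Matrix.star_vecMul, hH.inv.eq, ← Matrix.mul_vecMulVec,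
      ← Matrix.vecMulVec_mul, ← Matrix.mul_assoc]
    change (F x + G x)⁻¹ * gramG S a G C x * (F x + G x)⁻¹ = M
    rw [hM, ← Matrix.mul_assoc, ← Matrix.mul_assoc, Matrix.nonsing_inv_mul _ hx, Matrix.one_mul,
      Matrix.mul_assoc, Matrix.mul_nonsing_inv _ hx, Matrix.mul_one]
  rw [← h]
  rfl

theorem aestronglyMeasurable_specChar {S : Finset ℤ} {a : ℕ → Fin T → ℂ}
    (ha : Summable fun j : ZS S => ∑ k, ‖a j k‖) {F G : MatFun T} (hF : IsSpectralDensity F)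
    (hW : IsMinimalDensity (F + G)) {C : VecFun T} (hC : AEStronglyMeasurable C freqMeasure) :
    AEStronglyMeasurable (specChar S a F G C) freqMeasure :=
  ((hF.entrywiseAESM.mul hW.entrywiseAESM_inv).vecMul
    (continuous_funcA ha).aestronglyMeasurable).sub (hW.entrywiseAESM_inv.vecMul hC)

theorem mse_congr {S : Finset ℤ} {a : ℕ → Fin T → ℂ} {F G : MatFun T} {g h : VecFun T}
    (hgh : g =ᵐ[freqMeasure] h) : mse S a g F G = mse S a h F G := by
  rw [mse, mse, energy_congr hgh, energy_congr ((EventuallyEq.refl _ (funcA S a)).sub hgh)]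

theorem MemL2s.congr {S : Finset ℤ} {W : MatFun T} {g h : VecFun T} (hh : MemL2s S W h)
    (hgh : g =ᵐ[freqMeasure] h) : MemL2s S W g := by
  refine ⟨⟨hh.1.1.congr hgh.symm, by rw [energy_congr hgh]; exact hh.1.2⟩, fun ε hε => ?_⟩
  obtain ⟨c, hc, hlt⟩ := hh.2 ε hε
  exact ⟨c, hc, by rwa [energy_congr (hgh.sub (EventuallyEq.refl _ (trigPoly c)))]⟩

end Filtering

end

/-! ### Least favorable density and minimax-robust characteristic -/

open Filtering in
theorem corollary4 {T : ℕ}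
    (S : Finset ℤ) (hS : ∀ j ∈ S, j < 0)
    (a : ℕ → Fin T → ℂ) (ha : Summable fun j : ZS S => ∑ k, ‖a j k‖)
    (K : ClassData T) (G F₀ : MatFun T)
    (hG : IsSpectralDensity G) (hF₀ : F₀ ∈ K.densities)
    (hmin : Minimality F₀ G)
    (C : VecFun T) (hC : IsInverseSeries S a F₀ G C)
    (hrel : K.relation S a F₀ G C)
    (hext : SolvesExtremal S a K.densities {G} F₀ G) :
    IsLeastFavorable S a K.densities {G} F₀ G ∧
    IsOptimal S a F₀ G (specChar S a F₀ G C) ∧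
    ∀ h : VecFun T, IsMinimaxRobust S a K.densities {G} h ↔
      h =ᵐ[freqMeasure] specChar S a F₀ G C := by
  have hW := hmin.isMinimalDensity hF₀.1 hG
  set h₀ := specChar S a F₀ G C with hh₀
  have hh₀m : AEStronglyMeasurable h₀ freqMeasure :=
    aestronglyMeasurable_specChar ha hF₀.1 hW hC.choose_spec.1
  obtain ⟨M, hM, v, hv⟩ := K.exists_multiplier hrel
  have hgram : ∀ᵐ x ∂freqMeasure, ∀ i j,
      star ((funcA S a x - h₀ x) i) * (funcA S a x - h₀ x) j = M i j := by
    filter_upwards [hM, hW.density.2, hmin.1] with x h1 h2 h3 i j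
    exact gram_residual h2.isHermitian h3 h1 i j
  have hub : ∀ᵐ x ∂freqMeasure, ∀ i, ‖(funcA S a x - h₀ x) i‖ ^ 2 = ‖M i i‖ := by
    filter_upwards [hgram] with x hx i
    rw [← hx i i, norm_mul, norm_star, sq]
  have hubs : ∀ᵐ x ∂freqMeasure, ∑ i, ‖(funcA S a x - h₀ x) i‖ ^ 2 ≤ ∑ i, ‖M i i‖ := by
    filter_upwards [hub] with x hx
    exact (Finset.sum_congr rfl fun i _ => hx i).le
  obtain ⟨N, hN⟩ := bounded_of_continuous (continuous_funcA ha)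
  -- The bounds at hand are on squares; t ≤ t² + 1 accounts for each added 1.
  have hbd : ∀ᵐ x ∂freqMeasure, ∀ i, ‖h₀ x i‖ ≤ (N + 1) + ((∑ i, ‖M i i‖) + 1) := by
    filter_upwards [hubs] with x hx i
    have h1 : ‖funcA S a x i‖ ^ 2 ≤ N := (Finset.single_le_sum
      (f := fun k => ‖funcA S a x k‖ ^ 2) (fun _ _ => by positivity) (Finset.mem_univ i)).trans
      (hN x)
    have h2 : ‖(funcA S a x - h₀ x) i‖ ^ 2 ≤ ∑ i, ‖M i i‖ := (Finset.single_le_sum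
      (f := fun k => ‖(funcA S a x - h₀ x) k‖ ^ 2) (fun _ _ => by positivity)
      (Finset.mem_univ i)).trans hx
    have h3 : h₀ x i = funcA S a x i - (funcA S a x - h₀ x) i := by simp
    rw [h3]
    refine (norm_sub_le _ _).trans (add_le_add ?_ ?_)
    · nlinarith [sq_nonneg (‖funcA S a x i‖ - 1)]
    · nlinarith [sq_nonneg (‖(funcA S a x - h₀ x) i‖ - 1)]
  have hmem : ∀ F ∈ K.densities, MemL2s S (F + G) h₀ := fun F hF =>
    memL2s_of_bounded hh₀m hbd
      (fun n hn k => fourierCoeff_specChar ha hF₀.1 hG hmin hC hn k) (hF.1.add hG)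
  have hFi : ∀ F ∈ K.densities, Integrable (fun x => (sform (F x) (funcA S a x - h₀ x)
      (funcA S a x - h₀ x)).re) freqMeasure := fun F hF =>
    integrable_sform_of_bounded hF.1.1
      ((continuous_funcA ha).aestronglyMeasurable.sub hh₀m) hubs
  have hGi : Integrable (fun x => (sform (G x) (h₀ x) (h₀ x)).re) freqMeasure :=
    integrable_sform_of_bounded hG.1 hh₀m (M := ∑ _i : Fin T, ((N + 1) + ((∑ i, ‖M i i‖) + 1)) ^ 2)
      (hbd.mono fun x hx => Finset.sum_le_sum fun i _ =>
        pow_le_pow_left₀ (norm_nonneg _) (hx i) 2)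
  -- The equalizer property: the residual has Gram matrix M, so the signal error is the integral of
  -- tr(F M), equal to v throughout the class.
  have hconst : ∀ F ∈ K.densities, mse S a h₀ F G = ENNReal.ofReal v.re + energy G h₀ := by
    intro F hF
    rw [mse]
    congr 1
    refine (energy_eq_ofReal_integral hF.1.2 (hFi F hF)).trans ?_
    have hi : Integrable (fun x => ∑ i, ∑ j, F x i j * M j i) freqMeasure :=
      integrable_finsetSum _ fun i _ => integrable_finsetSum _ fun j _ => (hF.1.1 i j).mul_const _
    have hre : (∫ x, (∑ i, ∑ j, F x i j * M j i).re ∂freqMeasure) = v.re := by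
      rw [← hv F hF]
      exact integral_re hi
    rw [← hre]
    congr 1
    refine integral_congr_ae ?_
    filter_upwards [hgram] with x hx
    rw [sform_eq_sum]
    congr 1
    refine Finset.sum_congr rfl fun i _ => Finset.sum_congr rfl fun j _ => ?_
    rw [← hx j i]
    ring
  have hfin : mse S a h₀ F₀ G ≠ ∞ := by
    rw [hconst F₀ hF₀]
    exact ENNReal.add_ne_top.2 ⟨ENNReal.ofReal_ne_top,
      (energy_lt_top_of_integrable hG.2 hGi).ne⟩
  have hpyth : ∀ g, MemL2s S (F₀ + G) g →
      mse S a g F₀ G = mse S a h₀ F₀ G + energy (F₀ + G) (g - h₀) := fun g hg =>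
    mse_eq_add_energy hF₀.1 hG hmin hC (hFi F₀ hF₀) hGi (hmem F₀ hF₀) hg
  have hopt : IsOptimal S a F₀ G h₀ :=
    ⟨hmem F₀ hF₀, fun g hg => by rw [hpyth g hg]; exact le_self_add⟩
  have hsup : (⨆ F ∈ K.densities, ⨆ G' ∈ ({G} : Set (MatFun T)), mse S a h₀ F G') ≤
      mse S a h₀ F₀ G := by
    refine iSup₂_le fun F hF => iSup₂_le fun G' hG' => ?_
    rw [Set.mem_singleton_iff.1 hG', hconst F hF, hconst F₀ hF₀]
  have hle_sup (h : VecFun T) : mse S a h F₀ G ≤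
      ⨆ F ∈ K.densities, ⨆ G' ∈ ({G} : Set (MatFun T)), mse S a h F G' :=
    le_iSup₂_of_le F₀ hF₀ (le_iSup₂_of_le G (Set.mem_singleton G) le_rfl)
  have hHD : MemHD S K.densities {G} h₀ := by
    intro F hF G' hG'
    rw [Set.mem_singleton_iff.1 hG']
    exact hmem F hF
  refine ⟨⟨hF₀, Set.mem_singleton G, fun F hF G' hG' => ?_⟩, hopt, fun h => ⟨fun hh => ?_,
    fun hh => ?_⟩⟩
  · rw [Set.mem_singleton_iff.1 hG']
    calc optMse S a F G ≤ mse S a h₀ F G :=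
          iInf_le (fun h : {h : VecFun T // MemL2s S (F + G) h} => mse S a h F G)
            ⟨h₀, hmem F hF⟩
      _ = mse S a h₀ F₀ G := by rw [hconst F hF, hconst F₀ hF₀]
      _ ≤ optMse S a F₀ G := le_iInf fun g => hopt.2 g g.2
  · have hmemh : MemL2s S (F₀ + G) h := hh.1 F₀ hF₀ G (Set.mem_singleton G)
    -- A minimax h is compared with h₀, whose worst error is already its error at F₀.
    have hle : mse S a h F₀ G ≤ mse S a h₀ F₀ G :=
      (hle_sup h).trans ((hh.2.2 h₀ hHD).trans hsup)
    rw [hpyth h hmemh] at hle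
    -- The finite error of h₀ cancels from the Pythagorean identity.
    have hzero : energy (F₀ + G) (h - h₀) = 0 := by
      refine nonpos_iff_eq_zero.1 ((ENNReal.add_le_add_iff_left hfin).1 ?_)
      rwa [add_zero]
    filter_upwards [ae_eq_zero_of_energy_eq_zero hW (hmemh.1.1.sub hh₀m) hzero] with x hx
    exact sub_eq_zero.1 hx
  · refine ⟨fun F hF G' hG' => (hHD F hF G' hG').congr hh, ⟨F₀, hF₀, G, Set.mem_singleton G,
      fun F hF G' hG' => ?_⟩, fun g hg => ?_⟩
    · rw [Set.mem_singleton_iff.1 hG', mse_congr hh, mse_congr hh, hconst F hF, hconst F₀ hF₀]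
    · simp only [mse_congr hh]
      exact hsup.trans ((hopt.2 g (hg F₀ hF₀ G (Set.mem_singleton G))).trans (hle_sup g))
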